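/- Let $\mathbb T$ be the group of complex numbers of modulus $1$, let $n\ge 0$, and let $M$ be a locally compact Hausdorff space with a continuous action $(s,x)\mapsto s\cdot x$ of $\mathbb T^n$ (no separability of $M$ is needed). Let $\Delta=M/\mathbb T^n$ with the quotient topology, $J:M\to\Delta$ the projection, and, for $y\in\Delta$, let $\mathbb T^n_y$ be the common isotropy group of the points of $J^{-1}(y)$. For $k\in\mathbb Z^n$ and $s\in\mathbb T^n$ put $\langle k,s\rangle=s_1^{k_1}\cdots s_n^{k_n}$ and $$\Delta(k)=\{y\in\Delta : \langle k,s\rangle=1\ \text{for all } s\in\mathbb T^n_y\},\qquad M_k=J^{-1}(\Delta(k)).$$ The dual group of $\mathbb T^n/\mathbb T^n_y$ is identified with the subgroup $\{k\in\mathbb Z^n : y\in\Delta(k)\}$ of $\mathbb Z^n$. Let $$G_0=\bigcup_{y\in\Delta}\{y\}\times\widehat{\mathbb T^n/\mathbb T^n_y}=\bigcup_{k\in\mathbb Z^n}\Delta(k)\times\{k\}\subset\Delta\times\mathbb Z^n$$ with the induced topology; it is a bundle of commutative groups over $\Delta$. Let $\sigma:\Delta\to M$ be a continuous section of $J$ (that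 is, $J\circ\sigma=\mathrm{id}_\Delta$), and for $k\in\mathbb Z^n$ let $k_\sigma:M_k\to\mathbb T$ be the well-defined function with $k_\sigma(s\cdot\sigma(y))=\langle k,s\rangle$ for $y\in\Delta(k)$, $s\in\mathbb T^n$. Then: 1. for every $k\in\mathbb Z^n$ the set $M_k$ is open in $M$ and the function $k_\sigma$ is continuous; 2. $G_0$ is étale, i.e. the projection $G_0\to\Delta$ is a local homeomorphism, and there is an isomorphism of $C^*$-algebras $\mathcal I:C_0(M)\to C^*(G_0)$ such that, for all $f\in C_c(G_0)$ and $x\in M$, $$(\mathcal I^{-1}f)(x)=\sum_{k\in\widehat{\mathbb T^n/\mathbb T^n_{J(x)}}} f(J(x),k)\,k_\sigma(x)$$ (a sum with finitely many non-zero terms). Here $C^*(G_0)$ is the $C^*$-algebra of the étale groupoid $G_0$: the completion of the $*$-algebra $C_c(G_0)$ of compactly supported continuous functions, with $$(f*g)(y,k)=\sum_{l\in\widehat{\mathbb T^n/\mathbb T^n_y}}f(y,l)\,g(y,k-l),\qquad f^*(y,k)=\overline{f(y,-k)},$$ for the norm $\|f\|=\sup_\pi\|\pi(f)\|$, where $\pi$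 runs over the non-degenerate $*$-representations of $C_c(G_0)$ by bounded operators on Hilbert spaces that satisfy $\|\pi(f)\|\le\sup_{y\in\Delta}\sum_{k}|f(y,k)|$ for all $f$. -/

import Mathlib

set_option linter.unusedSectionVars false

open Set Topology
open scoped ENNReal ZeroAtInfty CompactlySupported ComplexConjugate

noncomputable section

universe u v

/-! ## Étale bundles of commutative groups and their C⋆-algebras -/

/-- An étale bundle of commutative groups over `Y`, realised as a sub-bundle
`G = ⋃_y {y} × G_y` of the trivial bundle `Y × A` (with the induced topology), `A` being a
(discrete) commutative group. As a groupoid, its range and source maps are both the projection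
`G → Y`; étale means that this map is a local homeomorphism. -/
structure EtaleBundle (Y : Type u) (A : Type v) [TopologicalSpace Y] [AddCommGroup A]
    [TopologicalSpace A] where
  /-- the fibre `G_y` -/
  fiber : Y → AddSubgroup A
  /-- the projection of the total space on the base is a local homeomorphism -/
  etale : IsLocalHomeomorph (fun g : {p : Y × A // p.2 ∈ fiber p.1} => g.1.1)

namespace EtaleBundle

variable {Y : Type u} {A : Type v} [TopologicalSpace Y] [AddCommGroup A] [TopologicalSpace A]

/-- The total space `G = {(y, k) | k ∈ G_y}`, with the topology induced by `Y × A`. -/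
abbrev Total (E : EtaleBundle Y A) : Type (max u v) := {p : Y × A // p.2 ∈ E.fiber p.1}

/-- The vector space `C_c(G)`; below it is given the convolution product of the groupoid `G` (not
the pointwise product), and the involution of the groupoid `G`. -/
def Conv (E : EtaleBundle Y A) : Type (max u v) := C_c(E.Total, ℂ)

instance (E : EtaleBundle Y A) : FunLike E.Conv E.Total ℂ :=
  inferInstanceAs (FunLike C_c(E.Total, ℂ) E.Total ℂ)

instance (E : EtaleBundle Y A) : AddCommGroup E.Conv :=
  inferInstanceAs (AddCommGroup C_c(E.Total, ℂ))

instance (E : EtaleBundle Y A) : Module ℂ E.Conv :=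
  inferInstanceAs (Module ℂ C_c(E.Total, ℂ))

namespace Conv

variable {E : EtaleBundle Y A}

@[ext] theorem ext {f g : E.Conv} (h : ∀ p, f p = g p) : f = g := DFunLike.ext _ _ h

@[simp] theorem zero_apply (p : E.Total) : (0 : E.Conv) p = 0 := rfl

@[simp] theorem add_apply (f g : E.Conv) (p : E.Total) : (f + g) p = f p + g p := rfl

@[simp] theorem neg_apply (f : E.Conv) (p : E.Total) : (-f) p = -f p := rfl

@[simp] theorem sub_apply (f g : E.Conv) (p : E.Total) : (f - g) p = f p - g p := rfl

@[simp] theorem smul_apply (c : ℂ) (f : E.Conv) (p : E.Total) : (c • f) p = c * f p := rfl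

theorem continuous (f : E.Conv) : Continuous f :=
  (f : C_c(E.Total, ℂ)).toContinuousMap.continuous

theorem hasCompactSupport (f : E.Conv) : HasCompactSupport f :=
  CompactlySupportedContinuousMap.hasCompactSupport' (f : C_c(E.Total, ℂ))

/-- The value at `(y, k)` of the convolution product:
`(f * g)(y, k) = ∑_{l ∈ G_y} f(y, l) g(y, k - l)` (only finitely many terms are non-zero). -/
def mulFun (f g : E.Conv) (p : E.Total) : ℂ :=
  ∑ᶠ l : E.fiber p.1.1,
    f ⟨(p.1.1, (l : A)), l.2⟩ * g ⟨(p.1.1, p.1.2 - (l : A)), sub_mem p.2 l.2⟩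

/-- Extension of `f` by zero to the trivial bundle `Y × A`. -/
def zeroExt (f : E.Conv) : Y × A → ℂ := Function.extend Subtype.val f 0

theorem zeroExt_coe (f : E.Conv) (p : E.Total) : f.zeroExt p.1 = f p :=
  Subtype.val_injective.extend_apply _ _ _

theorem zeroExt_mk (f : E.Conv) (y : Y) (k : A) (h : k ∈ E.fiber y) :
    f.zeroExt (y, k) = f ⟨(y, k), h⟩ := f.zeroExt_coe ⟨(y, k), h⟩

theorem zeroExt_not_mem (f : E.Conv) (y : Y) (k : A) (h : k ∉ E.fiber y) :
    f.zeroExt (y, k) = 0 := by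
  refine Function.extend_apply' _ _ _ ?_
  rintro ⟨⟨p, hp⟩, rfl⟩
  exact h hp

section Discrete

variable [DiscreteTopology A]

/-- The (finite) set of all `k` such that `f(y, k) ≠ 0` for some `y`. -/
theorem finite_snd (f : E.Conv) : ((fun p : E.Total => p.1.2) '' tsupport f).Finite := by
  have h : IsCompact ((fun p : E.Total => p.1.2) '' tsupport f) :=
    IsCompact.image f.hasCompactSupport (by fun_prop)
  exact h.finite_of_discrete

/-- The elements of `A` occurring in the support of `f`. -/
def labels (f : E.Conv) : Finset A := f.finite_snd.toFinset

theorem mem_labels {f : E.Conv} {p : E.Total} (h : f p ≠ 0) : p.1.2 ∈ f.labels := by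
  simp only [labels, Set.Finite.mem_toFinset]
  exact ⟨p, subset_tsupport _ h, rfl⟩

theorem mem_labels_of_zeroExt {f : E.Conv} {y : Y} {k : A} (h : f.zeroExt (y, k) ≠ 0) :
    k ∈ f.labels := by
  by_cases hk : k ∈ E.fiber y
  · rw [zeroExt_mk f y k hk] at h
    exact mem_labels h
  · exact absurd (zeroExt_not_mem f y k hk) h

theorem isOpen_total (E : EtaleBundle Y A) : IsOpen {p : Y × A | p.2 ∈ E.fiber p.1} := by
  have h : ∀ k : A, IsOpen {y : Y | k ∈ E.fiber y} := by
    intro k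
    have h1 : IsOpen ((fun g : E.Total => g.1.1) '' {g : E.Total | g.1.2 = k}) := by
      refine E.etale.isOpenMap _ ?_
      exact (isOpen_discrete {k}).preimage (by fun_prop : Continuous fun g : E.Total => g.1.2)
    convert h1 using 1
    ext y
    constructor
    · intro hy
      exact ⟨⟨(y, k), hy⟩, rfl, rfl⟩
    · rintro ⟨⟨⟨y', k'⟩, hg⟩, rfl, rfl⟩
      exact hg
  have h2 : {p : Y × A | p.2 ∈ E.fiber p.1} = ⋃ k : A, {y : Y | k ∈ E.fiber y} ×ˢ {k} := by
    ext ⟨y, k⟩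
    simp
  rw [h2]
  exact isOpen_iUnion fun k => (h k).prod (isOpen_discrete _)

theorem mulFun_eq_sum (f g : E.Conv) (p : E.Total) :
    mulFun f g p = ∑ l ∈ f.labels, f.zeroExt (p.1.1, l) * g.zeroExt (p.1.1, p.1.2 - l) := by
  classical
  rw [mulFun]
  have h1 : ∀ l : E.fiber p.1.1,
      f ⟨(p.1.1, (l : A)), l.2⟩ * g ⟨(p.1.1, p.1.2 - (l : A)), sub_mem p.2 l.2⟩ =
      f.zeroExt (p.1.1, (l : A)) * g.zeroExt (p.1.1, p.1.2 - (l : A)) := by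
    intro l
    rw [zeroExt_mk f _ _ l.2, zeroExt_mk g _ _ (sub_mem p.2 l.2)]
  rw [finsum_congr h1]
  have h2 := finsum_set_coe_eq_finsum_mem (E.fiber p.1.1 : Set A)
    (f := fun l => f.zeroExt (p.1.1, l) * g.zeroExt (p.1.1, p.1.2 - l))
  refine h2.trans (finsum_mem_eq_sum_of_inter_support_eq _ ?_)
  ext l
  simp only [mem_inter_iff, Function.mem_support, SetLike.mem_coe]
  constructor
  · rintro ⟨_, h⟩
    exact ⟨mem_labels_of_zeroExt (left_ne_zero_of_mul h), h⟩
  · rintro ⟨_, h⟩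
    refine ⟨?_, h⟩
    by_contra hl
    exact left_ne_zero_of_mul h (zeroExt_not_mem f _ _ hl)

variable [T2Space Y]

theorem continuous_zeroExt (f : E.Conv) : Continuous f.zeroExt :=
  f.hasCompactSupport.continuous_extend_zero (isOpen_total E) f.continuous

theorem continuous_mulFun (f g : E.Conv) : Continuous (mulFun f g) := by
  have h : mulFun f g = fun p : E.Total =>
      ∑ l ∈ f.labels, f.zeroExt (p.1.1, l) * g.zeroExt (p.1.1, p.1.2 - l) :=
    funext (mulFun_eq_sum f g)
  rw [h]
  have hf := continuous_zeroExt f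
  have hg := continuous_zeroExt g
  fun_prop

theorem hasCompactSupport_mulFun (f g : E.Conv) : HasCompactSupport (mulFun f g) := by
  have hK : IsCompact (tsupport f ×ˢ tsupport g) :=
    IsCompact.prod f.hasCompactSupport g.hasCompactSupport
  have hC : IsClosed {q : E.Total × E.Total | q.1.1.1 = q.2.1.1} :=
    isClosed_eq (by fun_prop) (by fun_prop)
  have hL := hC.isClosedEmbedding_subtypeVal.isCompact_preimage hK
  let m : {q : E.Total × E.Total | q.1.1.1 = q.2.1.1} → E.Total := fun q =>
    ⟨(q.1.1.1.1, q.1.1.1.2 + q.1.2.1.2), add_mem q.1.1.2 (by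
      have h := q.1.2.2
      rw [← show q.1.1.1.1 = q.1.2.1.1 from q.2] at h
      exact h)⟩
  have hm : Continuous m := by
    refine Continuous.subtype_mk ?_ _
    fun_prop
  refine HasCompactSupport.intro (hL.image hm) fun p hp => ?_
  rw [mulFun]
  refine finsum_eq_zero_of_forall_eq_zero fun l => ?_
  by_contra hne
  refine hp ⟨⟨(⟨(p.1.1, (l : A)), l.2⟩, ⟨(p.1.1, p.1.2 - (l : A)), sub_mem p.2 l.2⟩), rfl⟩,
    ⟨subset_tsupport _ (left_ne_zero_of_mul hne), subset_tsupport _ (right_ne_zero_of_mul hne)⟩, ?_⟩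
  apply Subtype.ext
  simp [m]

/-- The convolution product on `C_c(G)`. -/
instance : Mul E.Conv where
  mul f g := (⟨⟨mulFun f g, continuous_mulFun f g⟩, hasCompactSupport_mulFun f g⟩ :
    C_c(E.Total, ℂ))

theorem mul_apply (f g : E.Conv) (p : E.Total) :
    (f * g) p = ∑ᶠ l : E.fiber p.1.1,
      f ⟨(p.1.1, (l : A)), l.2⟩ * g ⟨(p.1.1, p.1.2 - (l : A)), sub_mem p.2 l.2⟩ := rfl

/-- The restriction of `f` to the fibre at `y`, as an element of the group algebra of `A`; used
only to derive the algebraic laws of convolution. -/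
def fiberElt (y : Y) (f : E.Conv) : AddMonoidAlgebra ℂ A :=
  AddMonoidAlgebra.ofCoeff (Finsupp.onFinset f.labels (fun k => f.zeroExt (y, k))
    fun _ h => mem_labels_of_zeroExt h)

theorem fiberElt_coeff (y : Y) (f : E.Conv) (k : A) :
    (fiberElt y f).coeff k = f.zeroExt (y, k) := rfl

theorem fiberElt_ext {y : Y} {f : E.Conv} {x : AddMonoidAlgebra ℂ A}
    (h1 : ∀ k (hk : k ∈ E.fiber y), f ⟨(y, k), hk⟩ = x.coeff k)
    (h2 : ∀ k, k ∉ E.fiber y → x.coeff k = 0) : fiberElt y f = x := by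
  ext k
  rw [fiberElt_coeff]
  by_cases hk : k ∈ E.fiber y
  · rw [zeroExt_mk f y k hk, h1 k hk]
  · rw [zeroExt_not_mem f y k hk, h2 k hk]

theorem coeff_eq_zero {y : Y} (f : E.Conv) {k : A} (hk : k ∉ E.fiber y) :
    (fiberElt y f).coeff k = 0 := zeroExt_not_mem f y k hk

theorem coeff_eq {y : Y} (f : E.Conv) {k : A} (hk : k ∈ E.fiber y) :
    (fiberElt y f).coeff k = f ⟨(y, k), hk⟩ := zeroExt_mk f y k hk

theorem fiberElt_mul_coeff (y : Y) (f g : E.Conv) (k : A) :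
    (fiberElt y f * fiberElt y g).coeff k =
      ∑ l ∈ f.labels, f.zeroExt (y, l) * g.zeroExt (y, k - l) := by
  rw [AddMonoidAlgebra.coeff_mul_apply_left]
  refine (Finsupp.sum_of_support_subset _ (s := f.labels) ?_ _ (by simp)).trans ?_
  · intro l hl
    exact mem_labels_of_zeroExt (Finsupp.mem_support_iff.mp hl)
  · refine Finset.sum_congr rfl fun l _ => ?_
    rw [fiberElt_coeff, fiberElt_coeff, neg_add_eq_sub]

theorem fiberElt_mul (y : Y) (f g : E.Conv) :
    fiberElt y (f * g) = fiberElt y f * fiberElt y g := by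
  refine fiberElt_ext (fun k hk => ?_) fun k hk => ?_
  · rw [fiberElt_mul_coeff]
    exact mulFun_eq_sum f g ⟨(y, k), hk⟩
  · rw [fiberElt_mul_coeff]
    refine Finset.sum_eq_zero fun l _ => ?_
    by_cases hl : l ∈ E.fiber y
    · rw [zeroExt_not_mem g, mul_zero]
      intro h
      exact hk (by simpa using add_mem h hl)
    · rw [zeroExt_not_mem f _ _ hl, zero_mul]

theorem fiberElt_injective :
    Function.Injective fun (f : E.Conv) (y : Y) => fiberElt y f := by
  intro f g h
  ext p
  have h1 := congrArg (fun x => x.coeff p.1.2) (congrFun h p.1.1)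
  simp only [coeff_eq f p.2, coeff_eq g p.2] at h1
  exact h1

theorem fiberElt_add (y : Y) (f g : E.Conv) :
    fiberElt y (f + g) = fiberElt y f + fiberElt y g :=
  fiberElt_ext (fun k hk => by simp [coeff_eq _ hk]) fun k hk => by simp [coeff_eq_zero _ hk]

theorem fiberElt_zero (y : Y) : fiberElt y (0 : E.Conv) = 0 :=
  fiberElt_ext (fun k hk => by simp) fun k hk => by simp

theorem fiberElt_smul (y : Y) (c : ℂ) (f : E.Conv) :
    fiberElt y (c • f) = c • fiberElt y f :=
  fiberElt_ext (fun k hk => by simp [coeff_eq _ hk]) fun k hk => by simp [coeff_eq_zero _ hk]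

instance : NonUnitalCommRing E.Conv :=
  { (inferInstance : AddCommGroup E.Conv), (inferInstance : Mul E.Conv) with
    left_distrib := fun f g h => fiberElt_injective <| funext fun y => by
      simp only [fiberElt_mul, fiberElt_add, mul_add]
    right_distrib := fun f g h => fiberElt_injective <| funext fun y => by
      simp only [fiberElt_mul, fiberElt_add, add_mul]
    zero_mul := fun f => fiberElt_injective <| funext fun y => by
      simp only [fiberElt_mul, fiberElt_zero, zero_mul]
    mul_zero := fun f => fiberElt_injective <| funext fun y => by
      simp only [fiberElt_mul, fiberElt_zero, mul_zero]
    mul_assoc := fun f g h => fiberElt_injective <| funext fun y => by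
      simp only [fiberElt_mul, mul_assoc]
    mul_comm := fun f g => fiberElt_injective <| funext fun y => by
      simp only [fiberElt_mul, mul_comm] }

instance : IsScalarTower ℂ E.Conv E.Conv where
  smul_assoc c f g := fiberElt_injective <| funext fun y => by
    simp only [smul_eq_mul, fiberElt_mul, fiberElt_smul, smul_mul_assoc]

instance : SMulCommClass ℂ E.Conv E.Conv where
  smul_comm c f g := fiberElt_injective <| funext fun y => by
    simp only [smul_eq_mul, fiberElt_mul, fiberElt_smul, mul_smul_comm]

end Discrete

/-- The inverse of the groupoid `G`: `(y, k) ↦ (y, -k)`. -/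
def inv (p : E.Total) : E.Total := ⟨(p.1.1, -p.1.2), neg_mem p.2⟩

section Star

variable [DiscreteTopology A] [T2Space Y]

theorem continuous_inv : Continuous (inv : E.Total → E.Total) := by
  refine Continuous.subtype_mk ?_ _
  fun_prop

/-- The involution on `C_c(G)`: `f⋆(y, k)` is the complex conjugate of `f(y, -k)`. -/
instance : Star E.Conv where
  star f := (⟨⟨fun p => conj (f (inv p)),
      Complex.continuous_conj.comp (f.continuous.comp continuous_inv)⟩, by
      refine HasCompactSupport.intro
        (IsCompact.image f.hasCompactSupport continuous_inv) fun p hp => ?_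
      by_contra hne
      refine hp ⟨inv p, subset_tsupport _ fun h => hne ?_, Subtype.ext ?_⟩
      · simp [h]
      · simp [inv]⟩ : C_c(E.Total, ℂ))

theorem star_apply (f : E.Conv) (p : E.Total) : (star f) p = conj (f (inv p)) := rfl

instance : StarRing E.Conv where
  star_involutive f := by
    ext p
    simp only [star_apply, Complex.conj_conj]
    exact congrArg f (Subtype.ext (by simp [inv]))
  star_add f g := by
    ext p
    simp [star_apply]
  star_mul f g := by
    ext p
    rw [mul_comm f g, star_apply, mul_apply, mul_apply]
    refine ((starRingEnd ℂ).toAddMonoidHom.map_finsum_of_injective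
      (starRingEnd ℂ).injective _).trans ?_
    refine finsum_eq_of_bijective (fun l => -l) neg_involutive.bijective fun l => ?_
    simp only [star_apply]
    refine (map_mul (starRingEnd ℂ) _ _).trans ?_
    refine congrArg₂ (fun a b => conj a * conj b) (congrArg g (Subtype.ext ?_))
      (congrArg f (Subtype.ext ?_))
    · change (p.1.1, (l : A)) = (p.1.1, - -(l : A))
      rw [neg_neg]
    · change (p.1.1, -p.1.2 - (l : A)) = (p.1.1, -(p.1.2 - -(l : A)))
      rw [sub_neg_eq_add, neg_add']

instance : StarModule ℂ E.Conv where
  star_smul c f := by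
    ext p
    simp [star_apply]

end Star

/-- The `I`-norm of `f ∈ C_c(G)`: `‖f‖_I = sup_{y ∈ Y} ∑_{k ∈ G_y} |f(y, k)|`. (For a bundle of
groups the two suprema, over the fibres of the range map and over those of the source map, are
equal.) -/
def iNorm (f : E.Conv) : ℝ≥0∞ := ⨆ y : Y, ∑' k : E.fiber y, ‖f ⟨(y, (k : A)), k.2⟩‖ₑ

theorem iNorm_ne_top [DiscreteTopology A] (f : E.Conv) : f.iNorm ≠ ⊤ := by
  obtain ⟨C, hC⟩ := f.continuous.bounded_above_of_compact_support f.hasCompactSupport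
  have hb : ∀ p : E.Total, ‖f p‖ₑ ≤ ENNReal.ofReal C := fun p => by
    rw [← ofReal_norm]
    exact ENNReal.ofReal_le_ofReal (hC p)
  refine ne_top_of_le_ne_top (b := ∑ _l ∈ f.labels, ENNReal.ofReal C)
    (ENNReal.sum_ne_top.mpr fun _ _ => ENNReal.ofReal_ne_top) (iSup_le fun y => ?_)
  have h1 : ∀ k : E.fiber y, ‖f ⟨(y, (k : A)), k.2⟩‖ₑ = ‖f.zeroExt (y, (k : A))‖ₑ := fun k => by
    rw [zeroExt_mk f y k k.2]
  calc ∑' k : E.fiber y, ‖f ⟨(y, (k : A)), k.2⟩‖ₑ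
      = ∑' k : E.fiber y, ‖f.zeroExt (y, (k : A))‖ₑ := tsum_congr h1
    _ ≤ ∑' k : A, ‖f.zeroExt (y, k)‖ₑ :=
        ENNReal.tsum_comp_le_tsum_of_injective Subtype.val_injective
          (fun k => ‖f.zeroExt (y, k)‖ₑ)
    _ = ∑ k ∈ f.labels, ‖f.zeroExt (y, k)‖ₑ := tsum_eq_sum fun k hk => by
        by_contra h
        exact hk (mem_labels_of_zeroExt (enorm_ne_zero.mp h))
    _ ≤ ∑ _k ∈ f.labels, ENNReal.ofReal C := by
        refine Finset.sum_le_sum fun k _ => ?_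
        by_cases hk : k ∈ E.fiber y
        · rw [zeroExt_mk f y k hk]
          exact hb _
        · rw [zeroExt_not_mem f y k hk]
          simp

end Conv

variable [DiscreteTopology A] [T2Space Y]

/-- A bounded representation of `C_c(G)`: a non-degenerate ⋆-homomorphism into the bounded
operators of a Hilbert space, such that `‖π f‖ ≤ ‖f‖_I` for all `f`. (Such a `π` is automatically
continuous for the inductive limit topology. The Hilbert spaces range over the universe in which
`C_c(G)` lives, hence include up to isomorphism all Hilbert spaces of cyclic representations.) -/
structure Rep (E : EtaleBundle Y A) : Type (max u v + 1) where
  /-- the Hilbert space of the representation -/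
  H : Type (max u v)
  [normedAddCommGroup : NormedAddCommGroup H]
  [innerProductSpace : InnerProductSpace ℂ H]
  [completeSpace : CompleteSpace H]
  /-- the ⋆-homomorphism -/
  π : E.Conv →⋆ₙₐ[ℂ] (H →L[ℂ] H)
  nondegenerate : Dense (Submodule.span ℂ {η : H | ∃ f ξ, π f ξ = η} : Set H)
  bounded : ∀ f : E.Conv, ‖π f‖ₑ ≤ f.iNorm

attribute [instance] Rep.normedAddCommGroup Rep.innerProductSpace Rep.completeSpace

/-- The C⋆-algebra of all bounded families of operators, indexed by the bounded representations of
`C_c(G)`, with the supremum norm. -/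
def OpFamilies (E : EtaleBundle Y A) : Type (max u v + 1) :=
  lp (fun r : E.Rep => r.H →L[ℂ] r.H) ∞

instance (E : EtaleBundle Y A) : NonUnitalCStarAlgebra E.OpFamilies :=
  inferInstanceAs (NonUnitalCStarAlgebra (lp (fun r : E.Rep => r.H →L[ℂ] r.H) ∞))

/-- The direct sum of all bounded representations of `C_c(G)`, as a ⋆-homomorphism into the
C⋆-algebra of bounded families of operators; the norm of the image of `f` is the supremum of the
`‖π f‖` over all bounded representations `π`. -/
def universalRep (E : EtaleBundle Y A) : E.Conv →⋆ₙₐ[ℂ] E.OpFamilies where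
  toFun f := (⟨fun r => r.π f, memℓp_infty ⟨f.iNorm.toReal, by
    rintro _ ⟨r, rfl⟩
    have h := ENNReal.toReal_mono f.iNorm_ne_top (r.bounded f)
    rwa [toReal_enorm] at h⟩⟩ : lp (fun r : E.Rep => r.H →L[ℂ] r.H) ∞)
  map_smul' c f := Subtype.ext (funext fun r => map_smul r.π c f)
  map_zero' := Subtype.ext (funext fun r => map_zero r.π)
  map_add' f g := Subtype.ext (funext fun r => map_add r.π f g)
  map_mul' f g := Subtype.ext (funext fun r => map_mul r.π f g)
  map_star' f := Subtype.ext (funext fun r => map_star r.π f)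

/-- The norm closure of the image of `C_c(G)` under the universal representation. -/
def closedRange (E : EtaleBundle Y A) : NonUnitalStarSubalgebra ℂ E.OpFamilies :=
  (NonUnitalStarAlgHom.range E.universalRep).topologicalClosure

/-- The C⋆-algebra `C⋆(G)`: the completion of `C_c(G)` for the norm
`‖f‖ = sup {‖π f‖ | π a bounded representation}`, realised as the norm closure of the image of
`C_c(G)` under the direct sum of all bounded representations. -/
def CStar (E : EtaleBundle Y A) : Type (max u v + 1) := E.closedRange

instance (E : EtaleBundle Y A) : NonUnitalCStarAlgebra E.CStar :=
  NonUnitalStarSubalgebra.nonUnitalCStarAlgebra E.closedRange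
    (h_closed := NonUnitalStarSubalgebra.isClosed_topologicalClosure _)

/-- The canonical ⋆-homomorphism `C_c(G) → C⋆(G)`. -/
def toCStar (E : EtaleBundle Y A) : E.Conv →⋆ₙₐ[ℂ] E.CStar :=
  NonUnitalStarAlgHom.codRestrict E.universalRep E.closedRange fun f =>
    NonUnitalStarSubalgebra.le_topologicalClosure _ ⟨f, rfl⟩

/-- The norm of `C⋆(G)` on `C_c(G)` is the full norm. -/
theorem norm_toCStar (E : EtaleBundle Y A) (f : E.Conv) :
    ‖E.toCStar f‖ = ⨆ r : E.Rep, ‖r.π f‖ :=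
  lp.norm_eq_ciSup (E.universalRep f : lp (fun r : E.Rep => r.H →L[ℂ] r.H) ∞)

/-- `C_c(G)` is dense in `C⋆(G)`. -/
theorem denseRange_toCStar (E : EtaleBundle Y A) : DenseRange E.toCStar := by
  intro x
  refine Metric.mem_closure_iff.mpr fun ε hε => ?_
  have hx : x.1 ∈ closure (Set.range E.universalRep) := x.2
  obtain ⟨_, ⟨f, rfl⟩, hf⟩ := Metric.mem_closure_iff.mp hx ε hε
  exact ⟨E.toCStar f, ⟨f, rfl⟩, hf⟩

end EtaleBundle

/-! ## Torus actions -/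

namespace TorusSpace

/-- The torus `𝕋ⁿ`. -/
abbrev Torus (n : ℕ) : Type := Fin n → Circle

/-- The duality bracket `⟨k, s⟩ = s₁^{k₁} ⋯ sₙ^{kₙ}` of `ℤⁿ` and `𝕋ⁿ`. -/
def bracket {n : ℕ} (k : Fin n → ℤ) (s : Torus n) : Circle := ∏ i, s i ^ k i

variable (n : ℕ) (M : Type u) [MulAction (Torus n) M]

/-- The quotient space `Δ = M/𝕋ⁿ`, with the quotient topology. -/
abbrev Delta : Type u := MulAction.orbitRel.Quotient (Torus n) M

/-- The canonical projection `J : M → Δ`. -/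
def J (x : M) : Delta n M := Quotient.mk (MulAction.orbitRel (Torus n) M) x

/-- The common isotropy group `𝕋ⁿ_y` of all points of `M` above `y ∈ Δ`. -/
def isotropy (y : Delta n M) : Subgroup (Torus n) :=
  Quotient.liftOn y (fun x => MulAction.stabilizer (Torus n) x) (by
    rintro _ b ⟨g, rfl⟩
    ext s
    simp only [MulAction.mem_stabilizer_iff]
    rw [smul_smul, mul_comm, mul_smul, smul_left_cancel_iff])

/-- The dual of `𝕋ⁿ/𝕋ⁿ_y`, as a subgroup of the dual `ℤⁿ` of `𝕋ⁿ`: the `k ∈ ℤⁿ` such that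
`⟨k, s⟩ = 1` for all `s ∈ 𝕋ⁿ_y`. -/
def dualFiber (y : Delta n M) : AddSubgroup (Fin n → ℤ) where
  carrier := {k | ∀ s ∈ isotropy n M y, bracket k s = 1}
  zero_mem' s _ := by simp [bracket]
  add_mem' {k l} hk hl s hs := by
    have h : bracket (k + l) s = bracket k s * bracket l s := by
      simp [bracket, zpow_add, Finset.prod_mul_distrib]
    rw [h, hk s hs, hl s hs, mul_one]
  neg_mem' {k} hk s hs := by
    have h : bracket (-k) s = (bracket k s)⁻¹ := by
      simp [bracket]
    rw [h, hk s hs, inv_one]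

/-- `Δ(k) = {y ∈ Δ | ⟨k, s⟩ = 1 for all s ∈ 𝕋ⁿ_y}`, the set of all `y` such that `k` belongs to
the dual of `𝕋ⁿ/𝕋ⁿ_y`. -/
def DeltaSet (k : Fin n → ℤ) : Set (Delta n M) := {y | ∀ s ∈ isotropy n M y, bracket k s = 1}

/-- `M_k = J⁻¹(Δ(k))`. -/
def MSet (k : Fin n → ℤ) : Set M := J n M ⁻¹' DeltaSet n M k

variable {n M}

theorem exists_smul_section {σ : Delta n M → M} (hσ : ∀ y, J n M (σ y) = y) (x : M) :
    ∃ s : Torus n, s • σ (J n M x) = x :=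
  MulAction.orbitRel_apply.mp (Quotient.exact (hσ (J n M x)).symm)

/-- The function `k_σ : M_k → 𝕋`, `k_σ(s • σ(y)) = ⟨k, s⟩` for `y ∈ Δ(k)` and `s ∈ 𝕋ⁿ`. -/
def kSigma {σ : Delta n M → M} (hσ : ∀ y, J n M (σ y) = y) (k : Fin n → ℤ) (x : MSet n M k) :
    Circle :=
  bracket k (exists_smul_section hσ (x : M)).choose

/-- `k_σ` does not depend on the choice made in its definition. -/
theorem kSigma_eq {σ : Delta n M → M} (hσ : ∀ y, J n M (σ y) = y) (k : Fin n → ℤ)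
    (x : MSet n M k) (s : Torus n) (hs : s • σ (J n M (x : M)) = x) :
    kSigma hσ k x = bracket k s := by
  have h := (exists_smul_section hσ (x : M)).choose_spec
  unfold kSigma
  set t := (exists_smul_section hσ (x : M)).choose
  have h1 : s⁻¹ * t ∈ isotropy n M (J n M (x : M)) := by
    rw [← hσ (J n M (x : M))]
    change s⁻¹ * t ∈ MulAction.stabilizer (Torus n) (σ (J n M (x : M)))
    rw [MulAction.mem_stabilizer_iff, mul_smul, h, inv_smul_eq_iff, hs]
  have h2 : bracket k (s⁻¹ * t) = (bracket k s)⁻¹ * bracket k t := by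
    simp [bracket, mul_zpow, Finset.prod_mul_distrib]
  have h3 := x.2 _ h1
  rw [h2, inv_mul_eq_one] at h3
  exact h3.symm

variable [TopologicalSpace M]

/-- `Δ` is Hausdorff if `M` is. -/
instance [T2Space M] [ContinuousSMul (Torus n) M] : T2Space (Delta n M) := by
  have hq : IsOpenQuotientMap (Quotient.mk (MulAction.orbitRel (Torus n) M)) :=
    MulAction.isOpenQuotientMap_quotientMk
  rw [t2Space_iff_of_isOpenQuotientMap hq]
  have h : IsClosed {q : Torus n × M × M | q.1 • q.2.2 = q.2.1} :=
    isClosed_eq (by fun_prop) (by fun_prop)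
  have h2 := isClosedMap_snd_of_compactSpace _ h
  convert h2 using 1
  ext ⟨a, b⟩
  constructor
  · intro hab
    obtain ⟨s, hs⟩ := MulAction.orbitRel_apply.mp (Quotient.exact hab)
    exact ⟨(s, a, b), hs, rfl⟩
  · rintro ⟨⟨s, a', b'⟩, hs, hab⟩
    obtain ⟨rfl, rfl⟩ := Prod.mk.inj hab
    exact Quotient.sound (MulAction.orbitRel_apply.mpr ⟨s, hs⟩)

variable (n M)

/-- The projection `G₀ → Δ`, where `G₀ = ⋃_{y ∈ Δ} (𝕋ⁿ/𝕋ⁿ_y)^ = ⋃_{k ∈ ℤⁿ} Δ(k) × {k}` is the bundle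
of the duals of the groups `𝕋ⁿ/𝕋ⁿ_y`, with the topology induced by `Δ × ℤⁿ`. -/
def dualProj : {p : Delta n M × (Fin n → ℤ) // p.2 ∈ dualFiber n M p.1} → Delta n M :=
  fun g => g.1.1

/-- The bundle `G₀`, as an étale bundle of commutative groups over `Δ`, given that `G₀ → Δ` is a
local homeomorphism. -/
def G₀ (h : IsLocalHomeomorph (dualProj n M)) : EtaleBundle (Delta n M) (Fin n → ℤ) where
  fiber := dualFiber n M
  etale := h

end TorusSpace

end

/-! The isomorphism is Fourier analysis along the orbits. The section identifies the orbit over `y`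
with `𝕋ⁿ/𝕋ⁿ_y`. A function `f` in `C_c(G₀)` is a family of trigonometric polynomials, one for each
orbit, and convolution along the fibres becomes pointwise multiplication. Summing the polynomials
gives the ⋆-homomorphism `gelfandHom` into `C₀(M)`. It remains to see that it has dense range and
carries the full norm to the sup norm; completing then gives the isomorphism
(`exists_starAlgEquiv_of_denseRange`).

Topology: the torus is compact, so projections along it are closed maps, and the circle has no small
subgroups. Hence `Δ(k)` is open (`isOpen_DeltaSet`), and each slice `Δ(k) × {k}` is an open piece of
`G₀` on which the projection is an open embedding.

Norms: evaluation at a point of `M` is a character bounded by the `I`-norm, so the sup norm is at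
most the full norm. Conversely, a trigonometric polynomial bounded by `C` has coefficients bounded
by `C`, so its `I`-norm is at most `C` times the number of its frequencies. For the `2^j`-th power
of a self-adjoint element that number grows polynomially in `2^j`, because `ℤⁿ` has polynomial
growth. Taking `2^j`-th roots removes it (`norm_rep_le_of_isSelfAdjoint`), and the C⋆-identity gives
the general case.

Density: by Stone-Weierstrass it is enough to separate points. Bump functions on `Δ` separate
different orbits; within one orbit, Fourier uniqueness provides enough characters trivial on the
isotropy group (`exists_bracket_ne_one`). -/

/-! ### Fourier analysis on the torus -/

noncomputable section TorusFourier

open MeasureTheory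

/-- The circle `ℝ / ℤ` with its normalised Haar measure. -/
local instance : MeasureSpace UnitAddCircle := ⟨AddCircle.haarAddCircle⟩

local instance : Measure.IsAddHaarMeasure (volume : Measure UnitAddCircle) :=
  inferInstanceAs (Measure.IsAddHaarMeasure AddCircle.haarAddCircle)

local instance : IsProbabilityMeasure (volume : Measure UnitAddCircle) :=
  inferInstanceAs (IsProbabilityMeasure AddCircle.haarAddCircle)

namespace UnitAddTorus

variable {d : Type*} [Fintype d]

theorem integral_mFourier_neg_mul_mFourier [DecidableEq d] (k l : d → ℤ) :
    ∫ t, mFourier (-k) t * mFourier l t = if k = l then 1 else 0 := by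
  have h := orthonormal_iff_ite.mp (orthonormal_mFourier (d := d)) k l
  rw [← h, ContinuousMap.inner_toLp]
  simp only [mFourier_neg, mul_comm]

theorem integrable_mFourier_mul (k : d → ℤ) (v : C(UnitAddTorus d, ℂ)) :
    Integrable (fun t => mFourier k t * v t) := by
  have hc : Continuous fun t => mFourier k t * v t := by fun_prop
  exact hc.integrable_of_hasCompactSupport (HasCompactSupport.of_compactSpace _)

/-- The coefficient is the integral of the polynomial against a function of modulus one, for a
probability measure. -/
theorem norm_coeff_le_of_forall_norm_sum_le (S : Finset (d → ℤ)) (a : (d → ℤ) → ℂ) {C : ℝ}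
    (hC : ∀ t, ‖∑ l ∈ S, a l * mFourier l t‖ ≤ C) {k : d → ℤ} (hk : k ∈ S) : ‖a k‖ ≤ C := by
  classical
  have h1 : ∫ t, mFourier (-k) t * ∑ l ∈ S, a l * mFourier l t = a k := by
    have h2 : ∀ t, mFourier (-k) t * ∑ l ∈ S, a l * mFourier l t =
        ∑ l ∈ S, a l * (mFourier (-k) t * mFourier l t) := fun t => by
      rw [Finset.mul_sum]
      exact Finset.sum_congr rfl fun l _ => by ring
    simp only [h2]
    rw [integral_finsetSum _ fun l _ => (integrable_mFourier_mul _ _).const_mul _]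
    simp only [integral_const_mul, integral_mFourier_neg_mul_mFourier]
    simp [hk]
  rw [← h1]
  refine (norm_integral_le_of_norm_le_const (C := C) (Filter.Eventually.of_forall fun t => ?_)).trans
    (by simp)
  rw [norm_mul]
  have h3 : ‖mFourier (-k) t‖ ≤ 1 := (ContinuousMap.norm_coe_le_norm _ t).trans mFourier_norm.le
  exact (mul_le_of_le_one_left (norm_nonneg _) h3).trans (hC t)

theorem mFourierCoeff_comp_add_right (v : UnitAddTorus d → ℂ) (r : UnitAddTorus d) (k : d → ℤ) :
    mFourierCoeff (fun t => v (t + r)) k = mFourier k r * mFourierCoeff v k := by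
  have h1 : ∀ t, mFourier (-k) t • v (t + r) =
      mFourier k r * (mFourier (-k) (t + r) • v (t + r)) := fun t => by
    have h2 : mFourier (-k) (t + r) = mFourier (-k) t * mFourier (-k) r := by
      simp [mFourier, smul_add, AddCircle.toCircle_add, Finset.prod_mul_distrib]
    have h3 : mFourier k r * mFourier (-k) r = 1 := by
      rw [← mFourier_add, add_neg_cancel, mFourier_zero, ContinuousMap.one_apply]
    rw [h2, smul_eq_mul, smul_eq_mul]
    linear_combination -mFourier (-k) t * v (t + r) * h3
  simp only [mFourierCoeff, h1, integral_const_mul]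
  congr 1
  exact integral_add_right_eq_self (fun t => mFourier (-k) t • v t) r

/-- A continuous function on the torus which is not invariant under translation by `r` has a
non-zero Fourier coefficient at some `k` with `mFourier k r ≠ 1`. -/
theorem exists_mFourierCoeff_ne_zero (v : C(UnitAddTorus d, ℂ)) (r t₀ : UnitAddTorus d)
    (h : v (t₀ + r) ≠ v t₀) : ∃ k : d → ℤ, mFourierCoeff v k ≠ 0 ∧ mFourier k r ≠ 1 := by
  by_contra! hc
  -- The coefficient of `w` at `k` is `mFourier k r - 1` times that of `v`, hence zero under the
  -- contrary assumption. The zero series is summable, so it converges pointwise to `w`, and `w t₀ =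
  -- 0`.
  let w : C(UnitAddTorus d, ℂ) := ⟨fun t => v (t + r) - v t, by fun_prop⟩
  have hw : mFourierCoeff w = 0 := by
    ext k
    have h1 : mFourierCoeff w k = mFourierCoeff (fun t => v (t + r)) k - mFourierCoeff v k := by
      simp only [mFourierCoeff, smul_eq_mul]
      refine Eq.trans ?_ (integral_sub
        (integrable_mFourier_mul (-k) ⟨fun t => v (t + r), by fun_prop⟩)
        (integrable_mFourier_mul (-k) v))
      simp only [w, ContinuousMap.coe_mk, mul_sub]
    rw [h1, mFourierCoeff_comp_add_right, Pi.zero_apply]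
    by_cases hk : mFourierCoeff v k = 0
    · simp [hk]
    · rw [hc k hk, one_mul, sub_self]
  have hs : Summable (mFourierCoeff w) := by rw [hw]; exact summable_zero
  have h2 := hasSum_mFourier_series_apply_of_summable hs t₀
  simp only [hw, Pi.zero_apply, zero_smul] at h2
  exact h (sub_eq_zero.mp (h2.unique hasSum_zero))

end UnitAddTorus

namespace TorusSpace

variable {n : ℕ}

/-- The exponential map `(ℝ / ℤ)ⁿ → 𝕋ⁿ`. -/
def torusExp (t : UnitAddTorus (Fin n)) : Torus n := fun i => (t i).toCircle

theorem continuous_torusExp : Continuous (torusExp : UnitAddTorus (Fin n) → Torus n) :=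
  continuous_pi fun i => AddCircle.continuous_toCircle.comp (continuous_apply i)

theorem torusExp_add (s t : UnitAddTorus (Fin n)) :
    torusExp (s + t) = torusExp s * torusExp t :=
  funext fun _ => AddCircle.toCircle_add _ _

theorem torusExp_surjective : Function.Surjective (torusExp : UnitAddTorus (Fin n) → Torus n) := by
  intro s
  refine ⟨fun i => (AddCircle.homeomorphCircle one_ne_zero).symm (s i), funext fun i => ?_⟩
  rw [torusExp, ← AddCircle.homeomorphCircle_apply one_ne_zero, Homeomorph.apply_symm_apply]

theorem mFourier_eq_bracket (k : Fin n → ℤ) (t : UnitAddTorus (Fin n)) :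
    UnitAddTorus.mFourier k t = (bracket k (torusExp t) : ℂ) := by
  simp only [UnitAddTorus.mFourier, ContinuousMap.coe_mk, fourier_apply, bracket, torusExp,
    AddCircle.toCircle_zsmul]
  exact (map_prod Circle.coeHom (fun i => (t i).toCircle ^ k i) _).symm

theorem norm_coeff_le_of_forall_norm_sum_bracket_le (S : Finset (Fin n → ℤ))
    (a : (Fin n → ℤ) → ℂ) {C : ℝ} (hC : ∀ s : Torus n, ‖∑ l ∈ S, a l * (bracket l s : ℂ)‖ ≤ C)
    {k : Fin n → ℤ} (hk : k ∈ S) : ‖a k‖ ≤ C :=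
  UnitAddTorus.norm_coeff_le_of_forall_norm_sum_le S a
    (fun t => by simpa only [mFourier_eq_bracket] using hC (torusExp t)) hk

/-- If a continuous function on the torus is invariant under translation by the elements of `H`
but not by `r`, then some character is trivial on `H` but not at `r`. -/
theorem exists_bracket_ne_one (H : Subgroup (Torus n)) (u : Torus n → ℂ) (hu : Continuous u)
    (hH : ∀ h ∈ H, ∀ s, u (s * h) = u s) {r s : Torus n} (hr : u (s * r) ≠ u s) :
    ∃ k : Fin n → ℤ, (∀ h ∈ H, bracket k h = 1) ∧ bracket k r ≠ 1 := by
  obtain ⟨r, rfl⟩ := torusExp_surjective r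
  obtain ⟨s, rfl⟩ := torusExp_surjective s
  let v : C(UnitAddTorus (Fin n), ℂ) := ⟨fun t => u (torusExp t), hu.comp continuous_torusExp⟩
  obtain ⟨k, hk, hkr⟩ := UnitAddTorus.exists_mFourierCoeff_ne_zero v r s
    (by simpa only [v, ContinuousMap.coe_mk, torusExp_add] using hr)
  refine ⟨k, fun h hh => ?_, fun h => hkr ?_⟩
  · obtain ⟨h, rfl⟩ := torusExp_surjective h
    -- Invariance under `h` gives `v̂(k) = ⟨k, h⟩ v̂(k)`, and `v̂(k) ≠ 0` can be cancelled.
    have h1 := UnitAddTorus.mFourierCoeff_comp_add_right v h k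
    have h2 : (fun t => v (t + h)) = v := funext fun t => by
      simp only [v, ContinuousMap.coe_mk, torusExp_add]
      exact hH _ hh _
    rw [h2, mFourier_eq_bracket] at h1
    exact Circle.ext ((mul_eq_right₀ hk).mp h1.symm)
  · rw [mFourier_eq_bracket, h, Circle.coe_one]

end TorusSpace

end TorusFourier

/-! ### Topology of the orbit space and of the dual bundle -/

noncomputable section TorusAction

/-- The circle has no small subgroups: as long as `w` is within `1/2` of `1`, one has `|w + 1| ≥
3/2`, so squaring moves `w` away from `1` by a factor of at least `3/2`. -/
theorem Circle.exists_pow_norm_sub_one_ge {z : Circle} (hz : z ≠ 1) :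
    ∃ m : ℕ, (1 / 2 : ℝ) ≤ ‖((z ^ m : Circle) : ℂ) - 1‖ := by
  by_contra! h
  have key : ∀ j : ℕ, (3 / 2 : ℝ) ^ j * ‖(z : ℂ) - 1‖ ≤ ‖((z ^ 2 ^ j : Circle) : ℂ) - 1‖ := by
    intro j
    induction j with
    | zero => simp
    | succ j ih =>
      set w : ℂ := ((z ^ 2 ^ j : Circle) : ℂ) with hw
      have h1 : ((z ^ 2 ^ (j + 1) : Circle) : ℂ) - 1 = (w + 1) * (w - 1) := by
        rw [pow_succ 2 j, pow_mul, Circle.coe_pow, ← hw]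
        ring
      have h2 : (3 / 2 : ℝ) ≤ ‖w + 1‖ := by
        have h3 : ‖w - 1‖ < 1 / 2 := h _
        have h4 : ‖(2 : ℂ)‖ ≤ ‖w + 1‖ + ‖w - 1‖ := by
          have := norm_sub_le (w + 1) (w - 1)
          rwa [show w + 1 - (w - 1) = 2 by ring] at this
        rw [Complex.norm_ofNat] at h4
        linarith
      rw [h1, norm_mul, pow_succ', mul_assoc]
      exact mul_le_mul h2 ih (by positivity) (norm_nonneg _)
  have hpos : 0 < ‖(z : ℂ) - 1‖ := by
    rw [norm_pos_iff, sub_ne_zero]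
    exact fun h => hz (Circle.ext h)
  obtain ⟨j, hj⟩ := pow_unbounded_of_one_lt (1 / ‖(z : ℂ) - 1‖) (by norm_num : (1 : ℝ) < 3 / 2)
  rw [div_lt_iff₀ hpos] at hj
  have := key j
  have := h (2 ^ j)
  linarith

namespace TorusSpace

variable {n : ℕ} {M : Type*} [MulAction (Torus n) M]

theorem bracket_mul (k : Fin n → ℤ) (s t : Torus n) :
    bracket k (s * t) = bracket k s * bracket k t := by
  simp [bracket, mul_zpow, Finset.prod_mul_distrib]

theorem bracket_add (k l : Fin n → ℤ) (s : Torus n) :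
    bracket (k + l) s = bracket k s * bracket l s := by
  simp [bracket, zpow_add, Finset.prod_mul_distrib]

theorem bracket_zero (s : Torus n) : bracket 0 s = 1 := by simp [bracket]

theorem bracket_neg (k : Fin n → ℤ) (s : Torus n) : bracket (-k) s = (bracket k s)⁻¹ := by
  simp [bracket]

theorem bracket_pow (k : Fin n → ℤ) (s : Torus n) (m : ℕ) :
    bracket k (s ^ m) = bracket k s ^ m := by
  simp only [bracket, Pi.pow_apply, ← Finset.prod_pow]
  exact Finset.prod_congr rfl fun i _ => by rw [← zpow_natCast, zpow_comm, zpow_natCast]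

theorem continuous_bracket (k : Fin n → ℤ) : Continuous (bracket k : Torus n → Circle) := by
  unfold bracket
  fun_prop

theorem J_smul (s : Torus n) (x : M) : J n M (s • x) = J n M x :=
  Quotient.sound (MulAction.orbitRel_apply.mpr ⟨s, rfl⟩)

theorem mem_isotropy_iff {y : Delta n M} {x : M} (hx : J n M x = y) {s : Torus n} :
    s ∈ isotropy n M y ↔ s • x = x := by
  subst hx
  exact MulAction.mem_stabilizer_iff

variable [TopologicalSpace M]

theorem continuous_J : Continuous (J n M) := continuous_quotient_mk'

instance [LocallyCompactSpace M] [ContinuousSMul (Torus n) M] :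
    LocallyCompactSpace (Delta n M) :=
  (MulAction.isOpenQuotientMap_quotientMk (T := M) (Γ := Torus n)).locallyCompactSpace

variable [ContinuousSMul (Torus n) M]

/-- The complement is the projection, along the compact torus, of the pairs `(s, y)` with `s` in the
isotropy group of `y` and `⟨k, s⟩ ≠ 1`. The last condition is not closed, but replacing `s` by a
power turns it into the closed condition `|⟨k, s⟩ - 1| ≥ 1/2`. -/
theorem isOpen_DeltaSet [T2Space M] (σ : C(Delta n M, M)) (hσ : ∀ y, J n M (σ y) = y)
    (k : Fin n → ℤ) : IsOpen (DeltaSet n M k) := by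
  have hC : IsClosed {q : Torus n × Delta n M |
      q.1 • σ q.2 = σ q.2 ∧ (1 / 2 : ℝ) ≤ ‖(bracket k q.1 : ℂ) - 1‖} := by
    have hb : Continuous fun q : Torus n × Delta n M => (bracket k q.1 : ℂ) :=
      continuous_subtype_val.comp ((continuous_bracket k).comp continuous_fst)
    exact (isClosed_eq (by fun_prop) (by fun_prop)).inter
      (isClosed_le continuous_const (hb.sub continuous_const).norm)
  have h := (isClosedMap_snd_of_compactSpace _ hC).isOpen_compl
  convert h using 1
  ext y
  simp only [DeltaSet, mem_ofPred_eq, mem_compl_iff, mem_image, Prod.exists, exists_eq_right,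
    not_exists]
  constructor
  · rintro hy s ⟨hs, hk⟩
    rw [hy s ((mem_isotropy_iff (hσ y)).mpr hs)] at hk
    norm_num at hk
  · intro hy s hs
    by_contra hne
    obtain ⟨m, hm⟩ := Circle.exists_pow_norm_sub_one_ge hne
    rw [← bracket_pow] at hm
    exact hy (s ^ m) ⟨(mem_isotropy_iff (hσ y)).mp (pow_mem hs m), hm⟩

theorem isOpen_MSet [T2Space M] (σ : C(Delta n M, M)) (hσ : ∀ y, J n M (σ y) = y)
    (k : Fin n → ℤ) : IsOpen (MSet n M k) :=
  (isOpen_DeltaSet σ hσ k).preimage continuous_J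

/-- The preimage of a closed set `C` is the projection along the compact torus of a closed set of
pairs `(s, x)`; no continuous choice of `s` is needed. -/
theorem continuous_kSigma [T2Space M] (σ : C(Delta n M, M)) (hσ : ∀ y, J n M (σ y) = y)
    (k : Fin n → ℤ) : Continuous (kSigma hσ k) := by
  refine continuous_iff_isClosed.mpr fun C hC => ?_
  have hP : IsClosed {q : Torus n × MSet n M k |
      q.1 • σ (J n M (q.2 : M)) = q.2 ∧ bracket k q.1 ∈ C} := by
    have hJ := continuous_J (n := n) (M := M)
    exact (isClosed_eq (by fun_prop) (by fun_prop)).inter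
      (hC.preimage ((continuous_bracket k).comp continuous_fst))
  convert isClosedMap_snd_of_compactSpace _ hP using 1
  ext x
  simp only [mem_preimage, mem_image, mem_ofPred_eq, Prod.exists, exists_eq_right]
  constructor
  · intro hx
    obtain ⟨s, hs⟩ := exists_smul_section hσ (x : M)
    exact ⟨s, hs, by rwa [← kSigma_eq hσ k x s hs]⟩
  · rintro ⟨s, hs, hC⟩
    rwa [kSigma_eq hσ k x s hs]

theorem isLocalHomeomorph_dualProj [T2Space M] (σ : C(Delta n M, M))
    (hσ : ∀ y, J n M (σ y) = y) : IsLocalHomeomorph (dualProj n M) := by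
  rw [isLocalHomeomorph_iff_isOpenEmbedding_restrict]
  intro g
  -- The slice of constant label is open since `ℤⁿ` is discrete, and it is a copy of the open set
  -- `Δ(k)`.
  set U : Set {p : Delta n M × (Fin n → ℤ) // p.2 ∈ dualFiber n M p.1} :=
    {p | p.1.2 = g.1.2} with hUdef
  have hU : IsOpen U :=
    (isOpen_discrete {g.1.2}).preimage (continuous_snd.comp continuous_subtype_val)
  refine ⟨U, hU.mem_nhds rfl, ?_⟩
  let i : DeltaSet n M g.1.2 → U := fun y => ⟨⟨(y, g.1.2), y.2⟩, rfl⟩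
  let e : U ≃ₜ DeltaSet n M g.1.2 :=
    { toFun := fun p => ⟨p.1.1.1, by
        have h1 := p.1.2
        rw [show p.1.1.2 = g.1.2 from p.2] at h1
        exact h1⟩
      invFun := i
      left_inv := fun p => Subtype.ext (Subtype.ext (Prod.ext rfl p.2.symm))
      right_inv := fun _ => rfl
      continuous_toFun := by fun_prop
      continuous_invFun := by fun_prop }
  exact (isOpen_DeltaSet σ hσ g.1.2).isOpenEmbedding_subtypeVal.comp e.isOpenEmbedding

end TorusSpace

end TorusAction

/-! ### Completions and Stone-Weierstrass -/

noncomputable section CStarPreliminaries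

theorem bijective_of_norm_map_of_denseRange {F D E : Type*} [NormedAddCommGroup D]
    [CompleteSpace D] [NormedAddCommGroup E] [FunLike F D E] [AddMonoidHomClass F D E] (p : F)
    (hp : ∀ x, ‖p x‖ = ‖x‖) (hd : DenseRange p) : Function.Bijective p := by
  have hi : Isometry p := AddMonoidHomClass.isometry_of_norm p hp
  refine ⟨hi.injective, fun b => ?_⟩
  rw [← mem_range, ← hi.isClosedEmbedding.isClosed_range.closure_eq]
  exact hd b

/-- Two ⋆-homomorphisms with dense ranges which induce the same norm have isomorphic
completions. -/
theorem exists_starAlgEquiv_of_denseRange {A B C : Type*} [NonUnitalRing A] [StarRing A]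
    [Module ℂ A] [NonUnitalCStarAlgebra B] [NonUnitalCStarAlgebra C] (ι : A →⋆ₙₐ[ℂ] B)
    (κ : A →⋆ₙₐ[ℂ] C) (hι : DenseRange ι) (hκ : DenseRange κ) (h : ∀ a, ‖ι a‖ = ‖κ a‖) :
    ∃ e : B ≃⋆ₐ[ℂ] C, ∀ a, e (ι a) = κ a := by
  -- `D` is the closure of the joint image of `A`. Its two coordinates have equal norms, so both
  -- projections are isometric with dense range, hence bijective; `D` is the graph of the
  -- isomorphism.
  let D : NonUnitalStarSubalgebra ℂ (B × C) :=
    (NonUnitalStarAlgHom.range (ι.prod κ)).topologicalClosure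
  have hDc : IsClosed (D : Set (B × C)) := NonUnitalStarSubalgebra.isClosed_topologicalClosure _
  have hmem : ∀ a, (ι a, κ a) ∈ D := fun a =>
    NonUnitalStarSubalgebra.le_topologicalClosure _ ⟨a, rfl⟩
  have hnorm : ∀ x : D, ‖x.1.1‖ = ‖x.1.2‖ := by
    rintro ⟨x, hx⟩
    have hcl : IsClosed {x : B × C | ‖x.1‖ = ‖x.2‖} := isClosed_eq (by fun_prop) (by fun_prop)
    refine closure_minimal ?_ hcl hx
    rintro _ ⟨a, rfl⟩
    exact h a
  have : CompleteSpace D := hDc.completeSpace_coe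
  let p : D →⋆ₙₐ[ℂ] B :=
    (NonUnitalStarAlgHom.fst ℂ B C).comp (NonUnitalStarSubalgebraClass.subtype D)
  let q : D →⋆ₙₐ[ℂ] C :=
    (NonUnitalStarAlgHom.snd ℂ B C).comp (NonUnitalStarSubalgebraClass.subtype D)
  have hp : Function.Bijective p := bijective_of_norm_map_of_denseRange p
    (fun x => (max_eq_left (hnorm x).ge).symm)
    (hι.mono (by rintro _ ⟨a, rfl⟩; exact ⟨⟨_, hmem a⟩, rfl⟩))
  have hq : Function.Bijective q := bijective_of_norm_map_of_denseRange q
    (fun x => (max_eq_right (hnorm x).le).symm)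
    (hκ.mono (by rintro _ ⟨a, rfl⟩; exact ⟨⟨_, hmem a⟩, rfl⟩))
  refine ⟨(StarAlgEquiv.ofBijective p hp).symm.trans (StarAlgEquiv.ofBijective q hq), fun a => ?_⟩
  have h1 : (StarAlgEquiv.ofBijective p hp).symm (ι a) = ⟨_, hmem a⟩ := by
    rw [StarAlgEquiv.symm_apply_eq]
    rfl
  rw [StarAlgEquiv.trans_apply, h1]
  rfl

variable {X : Type*} [TopologicalSpace X]

/-- The functions on the one-point compactification which are the sum of a constant and of an
element of `A`. -/
def NonUnitalStarSubalgebra.onePointExtension (A : NonUnitalStarSubalgebra ℂ C₀(X, ℂ)) :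
    StarSubalgebra ℂ C(OnePoint X, ℂ) where
  carrier := {g | ∃ a ∈ A, ∀ x : X, g x = g OnePoint.infty + a x}
  mul_mem' := by
    rintro f g ⟨a, ha, hf⟩ ⟨b, hb, hg⟩
    refine ⟨f OnePoint.infty • b + g OnePoint.infty • a + a * b,
      add_mem (add_mem (SMulMemClass.smul_mem _ hb) (SMulMemClass.smul_mem _ ha)) (mul_mem ha hb), fun x => ?_⟩
    simp only [ContinuousMap.mul_apply, hf x, hg x, ZeroAtInftyContinuousMap.add_apply,
      ZeroAtInftyContinuousMap.smul_apply, ZeroAtInftyContinuousMap.mul_apply, smul_eq_mul]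
    ring
  add_mem' := by
    rintro f g ⟨a, ha, hf⟩ ⟨b, hb, hg⟩
    refine ⟨a + b, add_mem ha hb, fun x => ?_⟩
    simp only [ContinuousMap.add_apply, hf x, hg x, ZeroAtInftyContinuousMap.add_apply]
    ring
  algebraMap_mem' c := ⟨0, zero_mem A, fun x => by simp⟩
  star_mem' := by
    rintro f ⟨a, ha, hf⟩
    exact ⟨star a, star_mem ha, fun x => by simp [hf x]⟩

/-- The **Stone-Weierstrass theorem** for functions vanishing at infinity. -/
theorem NonUnitalStarSubalgebra.dense_of_separatesPoints [T2Space X] [LocallyCompactSpace X]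
    (A : NonUnitalStarSubalgebra ℂ C₀(X, ℂ)) (h0 : ∀ x, ∃ a ∈ A, a x ≠ 0)
    (hA : ∀ x y, x ≠ y → ∃ a ∈ A, a x ≠ a y) : Dense (A : Set C₀(X, ℂ)) := by
  have hcont : ∀ a : C₀(X, ℂ),
      Filter.Tendsto (fun x => a x) (Filter.coclosedCompact X) (𝓝 0) := fun a => by
    rw [Filter.coclosedCompact_eq_cocompact]
    exact a.zero_at_infty'
  let ext : C₀(X, ℂ) → C(OnePoint X, ℂ) := fun a =>
    OnePoint.continuousMapMk (a : C(X, ℂ)) 0 (hcont a)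
  have ext_infty : ∀ a, ext a OnePoint.infty = 0 := fun _ => rfl
  have ext_coe : ∀ a (x : X), ext a x = a x := fun _ _ => rfl
  have ext_mem : ∀ a ∈ A, ext a ∈ A.onePointExtension := fun a ha =>
    ⟨a, ha, fun x => by rw [ext_infty, ext_coe, zero_add]⟩
  have hsep : A.onePointExtension.SeparatesPoints := by
    intro x y hxy
    -- Non-vanishing at each point (`h0`) is what separates points of `X` from infinity.
    have key : ∃ a ∈ A, ext a x ≠ ext a y := by
      induction x using OnePoint.rec with
      | infty =>
        induction y using OnePoint.rec with
        | infty => exact absurd rfl hxy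
        | coe y =>
          obtain ⟨a, ha, hy⟩ := h0 y
          exact ⟨a, ha, fun h => hy (by rw [← ext_coe, ← h, ext_infty])⟩
      | coe x =>
        induction y using OnePoint.rec with
        | infty =>
          obtain ⟨a, ha, hx⟩ := h0 x
          exact ⟨a, ha, fun h => hx (by rw [← ext_coe, h, ext_infty])⟩
        | coe y => exact hA x y fun h => hxy (by rw [h])
    obtain ⟨a, ha, h⟩ := key
    exact ⟨_, ⟨ext a, ext_mem a ha, rfl⟩, h⟩
  have htop := ContinuousMap.starSubalgebra_topologicalClosure_eq_top_of_separatesPoints _ hsep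
  intro f
  refine Metric.mem_closure_iff.mpr fun ε hε => ?_
  have hf : ext f ∈ A.onePointExtension.topologicalClosure := by
    rw [htop]
    exact StarSubalgebra.mem_top
  -- Since `ext f` vanishes at infinity, the constant part of `g` is itself below `ε / 4`. Dropping
  -- it leaves an error of at most `ε / 2`, which makes the final inequality strict.
  obtain ⟨g, ⟨a, ha, hg⟩, hfg⟩ := Metric.mem_closure_iff.mp hf (ε / 4) (by positivity)
  have hd : ∀ x, ‖ext f x - g x‖ < ε / 4 := fun x => by
    rw [← dist_eq_norm]
    exact (ContinuousMap.dist_apply_le_dist x).trans_lt hfg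
  refine ⟨a, ha, ?_⟩
  have hle : dist f a ≤ ε / 2 := by
    rw [← ZeroAtInftyContinuousMap.dist_toBCF_eq_dist,
      BoundedContinuousFunction.dist_le (by positivity)]
    intro x
    have h1 := hd x
    have h2 := hd OnePoint.infty
    rw [ext_infty, zero_sub, norm_neg] at h2
    rw [ext_coe, hg x] at h1
    have h3 : f x - a x = (f x - (g OnePoint.infty + a x)) + g OnePoint.infty := by ring
    change dist (f x) (a x) ≤ ε / 2
    rw [dist_eq_norm, h3]
    exact (norm_add_le _ _).trans (by linarith)
  linarith

end CStarPreliminaries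

/-! ### The transform from `C_c(G₀)` to `C₀(M)` -/

noncomputable section GelfandTransform

namespace EtaleBundle.Conv

variable {Y : Type*} {A : Type*} [TopologicalSpace Y] [AddCommGroup A] [TopologicalSpace A]
  {E : EtaleBundle Y A}

theorem zeroExt_star [DiscreteTopology A] [T2Space Y] (f : E.Conv) (y : Y) (k : A) :
    (star f).zeroExt (y, k) = conj (f.zeroExt (y, -k)) := by
  by_cases hk : k ∈ E.fiber y
  · rw [zeroExt_mk _ _ _ hk, zeroExt_mk _ _ _ (neg_mem hk)]
    rfl
  · rw [zeroExt_not_mem _ _ _ hk, zeroExt_not_mem _ _ _ (by simpa using hk), map_zero]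

end EtaleBundle.Conv

namespace TorusSpace

open EtaleBundle EtaleBundle.Conv

variable {n : ℕ}

/-- The ⋆-homomorphism `f ↦ ∑ₖ f(y, k) ⟨k, s⟩` from `C_c(E)` to `ℂ`. -/
def evalHom {Y : Type*} [TopologicalSpace Y] [T2Space Y] (E : EtaleBundle Y (Fin n → ℤ))
    (y : Y) (s : Torus n) : E.Conv →⋆ₙₐ[ℂ] ℂ :=
  -- A point `s` of the torus is a character of `ℤⁿ`, so it extends to the group algebra;
  -- composition with the multiplicative map `fiberElt y` gives the required map.
  let F : AddMonoidAlgebra ℂ (Fin n → ℤ) →ₐ[ℂ] ℂ := AddMonoidAlgebra.lift ℂ ℂ (Fin n → ℤ)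
    { toFun := fun k => (bracket k.toAdd s : ℂ)
      map_one' := by rw [toAdd_one, bracket_zero, Circle.coe_one]
      map_mul' := fun k l => by rw [toAdd_mul, bracket_add, Circle.coe_mul] }
  have hF : ∀ f : E.Conv, F (fiberElt y f) = ∑ᶠ k, f.zeroExt (y, k) * (bracket k s : ℂ) := by
    intro f
    rw [AddMonoidAlgebra.lift_apply, Finsupp.sum, finsum_eq_sum_of_support_subset _ (s := _)]
    · rfl
    · intro k hk
      exact Finsupp.mem_support_iff.mpr (left_ne_zero_of_mul hk)
  { toFun := fun f => F (fiberElt y f)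
    map_smul' := fun c f => by rw [fiberElt_smul, map_smul]; rfl
    map_zero' := by rw [fiberElt_zero, map_zero]
    map_add' := fun f g => by rw [fiberElt_add, map_add]
    map_mul' := fun f g => by rw [fiberElt_mul, map_mul]
    map_star' := fun f => by
      rw [hF, hF]
      symm
      refine ((starRingEnd ℂ).toAddMonoidHom.map_finsum_of_injective
        (starRingEnd ℂ).injective _).trans ?_
      refine finsum_eq_of_bijective (fun k => -k) neg_involutive.bijective fun k => ?_
      rw [zeroExt_star, neg_neg, bracket_neg, Circle.coe_inv_eq_conj]
      exact map_mul (starRingEnd ℂ) _ _ }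

section EvalHom

variable {Y : Type*} [TopologicalSpace Y] [T2Space Y] {E : EtaleBundle Y (Fin n → ℤ)}

theorem evalHom_eq_sum (y : Y) (s : Torus n) (f : E.Conv) {S : Finset (Fin n → ℤ)}
    (hS : ∀ k, f.zeroExt (y, k) ≠ 0 → k ∈ S) :
    evalHom E y s f = ∑ k ∈ S, f.zeroExt (y, k) * (bracket k s : ℂ) := by
  refine (AddMonoidAlgebra.lift_apply _ _).trans ?_
  refine Finsupp.sum_of_support_subset _ (fun k hk => ?_) _ (by simp)
  exact hS k (Finsupp.mem_support_iff.mp hk)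

theorem evalHom_congr {y : Y} {s t : Torus n} (h : ∀ k ∈ E.fiber y, bracket k s = bracket k t)
    (f : E.Conv) : evalHom E y s f = evalHom E y t f := by
  rw [evalHom_eq_sum y s f fun _ => mem_labels_of_zeroExt,
    evalHom_eq_sum y t f fun _ => mem_labels_of_zeroExt]
  refine Finset.sum_congr rfl fun k _ => ?_
  by_cases hk : k ∈ E.fiber y
  · rw [h k hk]
  · rw [zeroExt_not_mem _ _ _ hk, zero_mul, zero_mul]

theorem hasSum_evalHom (y : Y) (s : Torus n) (f : E.Conv) :
    HasSum (fun k : E.fiber y => f ⟨(y, (k : Fin n → ℤ)), k.2⟩ * (bracket (k : Fin n → ℤ) s : ℂ))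
      (evalHom E y s f) := by
  rw [evalHom_eq_sum y s f fun _ => mem_labels_of_zeroExt]
  have h1 : HasSum (fun k => f.zeroExt (y, k) * (bracket k s : ℂ))
      (∑ k ∈ f.labels, f.zeroExt (y, k) * (bracket k s : ℂ)) :=
    hasSum_sum_of_ne_finset_zero fun k hk => by
      by_contra h
      exact hk (mem_labels_of_zeroExt (left_ne_zero_of_mul h))
  have h2 : Function.support (fun k => f.zeroExt (y, k) * (bracket k s : ℂ)) ⊆
      (E.fiber y : Set (Fin n → ℤ)) := fun k hk => by
    by_contra h
    exact left_ne_zero_of_mul hk (zeroExt_not_mem _ _ _ h)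
  refine ((hasSum_subtype_iff_of_support_subset h2).mpr h1).congr_fun fun k => ?_
  simp only [Function.comp_apply]
  rw [zeroExt_mk f y k k.2]

end EvalHom

variable {M : Type*} [MulAction (Torus n) M] {σ : Delta n M → M}

/-- An element `s` of the torus such that `s • σ (J x) = x`. -/
def torusCoord (hσ : ∀ y, J n M (σ y) = y) (x : M) : Torus n :=
  (exists_smul_section hσ x).choose

theorem torusCoord_smul (hσ : ∀ y, J n M (σ y) = y) (x : M) :
    torusCoord hσ x • σ (J n M x) = x :=
  (exists_smul_section hσ x).choose_spec

/-- `torusCoord` is an arbitrary choice and need not be continuous; only its pairings with labels in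
the fibre are well defined, and these are the values of `k_σ`. -/
theorem bracket_torusCoord_eq (hσ : ∀ y, J n M (σ y) = y) {x : M} {s : Torus n}
    (hs : s • σ (J n M x) = x) {k : Fin n → ℤ} (hk : k ∈ dualFiber n M (J n M x)) :
    bracket k (torusCoord hσ x) = bracket k s :=
  kSigma_eq hσ k ⟨x, hk⟩ s hs

variable [TopologicalSpace M] [T2Space M] [ContinuousSMul (Torus n) M]

/-- On the open set `M_k` the bracket is the continuous function `k_σ`. At points outside, `g`
vanishes and the product, having the modulus of `g`, tends to zero. -/
theorem continuous_mul_bracket_torusCoord (σ : C(Delta n M, M)) (hσ : ∀ y, J n M (σ y) = y)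
    (k : Fin n → ℤ) {g : M → ℂ} (hg : Continuous g) (h0 : ∀ x ∉ MSet n M k, g x = 0) :
    Continuous fun x => g x * (bracket k (torusCoord hσ x) : ℂ) := by
  rw [continuous_iff_continuousAt]
  intro x
  by_cases hx : x ∈ MSet n M k
  · have h1 : ContinuousOn (fun x => (bracket k (torusCoord hσ x) : ℂ)) (MSet n M k) := by
      rw [continuousOn_iff_continuous_domRestrict]
      exact continuous_subtype_val.comp (continuous_kSigma σ hσ k)
    exact hg.continuousAt.mul (h1.continuousAt ((isOpen_MSet σ hσ k).mem_nhds hx))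
  · have h1 : g x = 0 := h0 x hx
    rw [ContinuousAt, h1, zero_mul]
    refine squeeze_zero_norm (a := fun x => ‖g x‖) (fun z => ?_) ?_
    · rw [norm_mul, Circle.norm_coe, mul_one]
    · have := hg.norm.tendsto x
      rwa [h1, norm_zero] at this

variable (h : IsLocalHomeomorph (dualProj n M)) (σ : C(Delta n M, M))
  (hσ : ∀ y, J n M (σ y) = y)

theorem continuous_evalHom (f : (G₀ n M h).Conv) :
    Continuous fun x => evalHom (G₀ n M h) (J n M x) (torusCoord hσ x) f := by
  simp only [evalHom_eq_sum _ _ f fun _ => mem_labels_of_zeroExt]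
  refine continuous_finsetSum _ fun k _ => ?_
  refine continuous_mul_bracket_torusCoord σ hσ k
    (f.continuous_zeroExt.comp (continuous_J.prodMk continuous_const)) fun x hx => ?_
  exact zeroExt_not_mem f _ _ hx

theorem hasCompactSupport_evalHom (f : (G₀ n M h).Conv) :
    HasCompactSupport fun x => evalHom (G₀ n M h) (J n M x) (torusCoord hσ x) f := by
  -- The function lives on the orbits above the projection of the support of `f`; the torus carries
  -- the image of this compact set under `σ` to a compact set.
  have hK : IsCompact ((fun q : Torus n × (G₀ n M h).Total => q.1 • σ q.2.1.1) ''
      (univ ×ˢ tsupport f)) :=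
    (isCompact_univ.prod f.hasCompactSupport).image (by fun_prop)
  refine HasCompactSupport.intro hK fun x hx => ?_
  rw [evalHom_eq_sum _ _ f fun _ => mem_labels_of_zeroExt]
  refine Finset.sum_eq_zero fun k _ => ?_
  by_contra hne
  by_cases hk : k ∈ (G₀ n M h).fiber (J n M x)
  · have h1 := left_ne_zero_of_mul hne
    rw [zeroExt_mk f _ _ hk] at h1
    exact hx ⟨(torusCoord hσ x, ⟨(J n M x, k), hk⟩), ⟨mem_univ _, subset_tsupport _ h1⟩,
      torusCoord_smul hσ x⟩
  · exact left_ne_zero_of_mul hne (zeroExt_not_mem f _ _ hk)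

/-- The ⋆-homomorphism `C_c(G₀) → C₀(M)` which maps `f` to `x ↦ ∑ₖ f(J(x), k) k_σ(x)`. -/
def gelfandHom : (G₀ n M h).Conv →⋆ₙₐ[ℂ] C₀(M, ℂ) where
  toFun f := ⟨⟨fun x => evalHom (G₀ n M h) (J n M x) (torusCoord hσ x) f,
    continuous_evalHom h σ hσ f⟩, (hasCompactSupport_evalHom h σ hσ f).is_zero_at_infty⟩
  map_smul' c f := by ext x; exact map_smul (evalHom (G₀ n M h) _ _) c f
  map_zero' := by ext x; exact map_zero (evalHom (G₀ n M h) _ _)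
  map_add' f g := by ext x; exact map_add (evalHom (G₀ n M h) _ _) f g
  map_mul' f g := by ext x; exact map_mul (evalHom (G₀ n M h) _ _) f g
  map_star' f := by ext x; exact map_star (evalHom (G₀ n M h) _ _) f

theorem gelfandHom_apply (f : (G₀ n M h).Conv) (x : M) :
    gelfandHom h σ hσ f x = evalHom (G₀ n M h) (J n M x) (torusCoord hσ x) f := rfl

/-- Makes a sup bound over `M` into a bound of `evalHom` at all pairs `(y, s)`. -/
theorem gelfandHom_smul_section (f : (G₀ n M h).Conv) (y : Delta n M) (s : Torus n) :
    gelfandHom h σ hσ f (s • σ y) = evalHom (G₀ n M h) y s f := by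
  have hy : J n M (s • σ y) = y := (J_smul s _).trans (hσ y)
  rw [gelfandHom_apply, hy]
  refine evalHom_congr (fun k hk => ?_) f
  exact bracket_torusCoord_eq hσ (by rw [hy]) (by rw [hy]; exact hk)

end TorusSpace

end GelfandTransform

/-! ### The full norm equals the sup norm -/

noncomputable section NormComparison

namespace EtaleBundle

variable {Y : Type*} {A : Type*} [TopologicalSpace Y] [AddCommGroup A] [TopologicalSpace A]
  {E : EtaleBundle Y A}

namespace Conv

theorem tsum_enorm_eq_sum (f : E.Conv) (y : Y) {S : Finset A}
    (hS : ∀ k, f.zeroExt (y, k) ≠ 0 → k ∈ S) :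
    ∑' k : E.fiber y, ‖f ⟨(y, (k : A)), k.2⟩‖ₑ = ∑ k ∈ S, ‖f.zeroExt (y, k)‖ₑ := by
  have h1 : ∀ k : E.fiber y, ‖f ⟨(y, (k : A)), k.2⟩‖ₑ = ‖f.zeroExt (y, (k : A))‖ₑ := fun k => by
    rw [zeroExt_mk f y k k.2]
  rw [tsum_congr h1]
  refine (tsum_subtype_eq_of_support_subset (s := (E.fiber y : Set A))
    (f := fun k => ‖f.zeroExt (y, k)‖ₑ) fun k hk => ?_).trans (tsum_eq_sum fun k hk => ?_)
  · by_contra hne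
    exact hk (enorm_eq_zero.mpr (zeroExt_not_mem f y k hne))
  · by_contra hne
    exact hk (hS k (enorm_ne_zero.mp hne))

theorem zeroExt_mul [DiscreteTopology A] [T2Space Y] (f g : E.Conv) (y : Y) (k : A) :
    (f * g).zeroExt (y, k) = ∑ l ∈ f.labels, f.zeroExt (y, l) * g.zeroExt (y, k - l) := by
  rw [← fiberElt_mul_coeff, ← fiberElt_mul, fiberElt_coeff]

theorem exists_zeroExt_ne_zero_of_mul [DiscreteTopology A] [T2Space Y] {f g : E.Conv} {y : Y}
    {k : A} (h : (f * g).zeroExt (y, k) ≠ 0) :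
    ∃ l, f.zeroExt (y, l) ≠ 0 ∧ g.zeroExt (y, k - l) ≠ 0 := by
  rw [zeroExt_mul] at h
  obtain ⟨l, -, hl⟩ := Finset.exists_ne_zero_of_sum_ne_zero h
  exact ⟨l, left_ne_zero_of_mul hl, right_ne_zero_of_mul hl⟩

end Conv

end EtaleBundle

/-- The integer points of the cube of radius `N`. -/
def intBox (n : ℕ) (N : ℕ) : Finset (Fin n → ℤ) :=
  Fintype.piFinset fun _ => Finset.Icc (-(N : ℤ)) N

theorem mem_intBox {n N : ℕ} {k : Fin n → ℤ} : k ∈ intBox n N ↔ ∀ i, |k i| ≤ N := by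
  simp [intBox, abs_le]

theorem card_intBox (n N : ℕ) : (intBox n N).card = (2 * N + 1) ^ n := by
  simp only [intBox, Fintype.card_piFinset, Int.card_Icc, Finset.prod_const, Finset.card_univ,
    Fintype.card_fin]
  congr 1
  omega

theorem add_mem_intBox {n N N' : ℕ} {k l : Fin n → ℤ} (hk : k ∈ intBox n N)
    (hl : l ∈ intBox n N') : k + l ∈ intBox n (N + N') := by
  rw [mem_intBox] at *
  intro i
  push_cast
  exact (abs_add_le _ _).trans (add_le_add (hk i) (hl i))

theorem exists_subset_intBox {n : ℕ} (S : Finset (Fin n → ℤ)) : ∃ N, S ⊆ intBox n N := by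
  refine ⟨S.sup fun k => Finset.univ.sup fun i => (k i).natAbs, fun k hk => ?_⟩
  rw [mem_intBox]
  intro i
  rw [Int.abs_eq_natAbs, Nat.cast_le]
  exact (Finset.le_sup (f := fun i => (k i).natAbs) (Finset.mem_univ i)).trans
    (Finset.le_sup (f := fun k : Fin n → ℤ => Finset.univ.sup fun i => (k i).natAbs) hk)

/-- If `b < a`, then `m ^ n * (b / a) ^ m` tends to zero, in particular along `m = 2 ^ j`, while the
hypothesis bounds it below by a positive constant. -/
theorem le_of_forall_pow_two_pow_le {a b : ℝ} (ha : 0 ≤ a) (hb : 0 ≤ b) (N n : ℕ)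
    (h : ∀ j : ℕ, a ^ 2 ^ j ≤ (2 * (2 ^ j * N : ℕ) + 1 : ℝ) ^ n * b ^ 2 ^ j) : a ≤ b := by
  by_contra! hab
  have ha' : 0 < a := hb.trans_lt hab
  have hlim := (tendsto_pow_const_mul_const_pow_of_lt_one n (div_nonneg hb ha)
    ((div_lt_one ha').mpr hab)).const_mul ((2 * N + 1 : ℝ) ^ n)
  rw [mul_zero] at hlim
  have hlim2 := hlim.comp (tendsto_pow_atTop_atTop_of_one_lt (one_lt_two : 1 < 2))
  obtain ⟨j, hj⟩ := (hlim2.eventually (gt_mem_nhds one_pos)).exists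
  simp only [Function.comp_apply] at hj
  have h1 : (2 * (2 ^ j * N : ℕ) + 1 : ℝ) ≤ (2 * N + 1) * (2 ^ j : ℕ) := by
    have : (1 : ℝ) ≤ 2 ^ j := one_le_pow₀ one_le_two
    push_cast
    nlinarith
  have h2 : a ^ 2 ^ j ≤ ((2 * N + 1) * (2 ^ j : ℕ)) ^ n * b ^ 2 ^ j :=
    (h j).trans (mul_le_mul_of_nonneg_right (pow_le_pow_left₀ (by positivity) h1 n) (by positivity))
  rw [div_pow, ← mul_assoc, ← mul_pow, mul_div_assoc', div_lt_one (by positivity)] at hj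
  exact absurd hj h2.not_gt

namespace TorusSpace

open EtaleBundle EtaleBundle.Conv

variable {n : ℕ}

section EvalRep

universe u

variable {Y : Type u} [TopologicalSpace Y] [T2Space Y] (E : EtaleBundle Y (Fin n → ℤ))

theorem enorm_evalHom_le (y : Y) (s : Torus n) (f : E.Conv) :
    ‖evalHom E y s f‖ₑ ≤ f.iNorm := by
  rw [evalHom_eq_sum y s f fun _ => mem_labels_of_zeroExt]
  refine (enorm_sum_le _ _).trans (le_trans (le_of_eq ?_) (le_iSup _ y))
  rw [tsum_enorm_eq_sum f y fun _ => mem_labels_of_zeroExt]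
  refine Finset.sum_congr rfl fun k _ => ?_
  have h1 : ‖(bracket k s : ℂ)‖ₑ = 1 := by
    rw [← ofReal_norm, Circle.norm_coe, ENNReal.ofReal_one]
  rw [enorm_mul, h1, mul_one]

/-- The one-dimensional representation given by a non-zero character `evalHom E y s`. -/
def evalRep (y : Y) (s : Torus n) (h : ∃ f, evalHom E y s f ≠ 0) : E.Rep where
  -- A copy of `ℂ` in the universe required by `Rep`.
  H := EuclideanSpace ℂ PUnit.{u + 1}
  π :=
    { toFun := fun f => evalHom E y s f • 1
      map_smul' := fun c f => by rw [map_smul, smul_assoc]; rfl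
      map_zero' := by rw [map_zero, zero_smul]
      map_add' := fun f g => by rw [map_add, add_smul]
      map_mul' := fun f g => by rw [map_mul, smul_mul_smul_comm, mul_one]
      map_star' := fun f => by rw [map_star, star_smul, star_one] }
  nondegenerate := by
    obtain ⟨f, hf⟩ := h
    have h1 : ∀ η : EuclideanSpace ℂ PUnit.{u + 1},
        η ∈ {η | ∃ f ξ, (evalHom E y s f • (1 : EuclideanSpace ℂ PUnit.{u + 1} →L[ℂ] _)) ξ = η} :=
      fun η => ⟨f, (evalHom E y s f)⁻¹ • η, smul_inv_smul₀ hf η⟩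
    intro η
    exact subset_closure (Submodule.subset_span (h1 η))
  bounded f := by
    refine le_trans (le_of_eq ?_) (enorm_evalHom_le E y s f)
    change ‖evalHom E y s f •
      (1 : EuclideanSpace ℂ PUnit.{u + 1} →L[ℂ] EuclideanSpace ℂ PUnit.{u + 1})‖ₑ = _
    rw [← ofReal_norm, ← ofReal_norm, norm_smul, norm_one, mul_one]

theorem norm_evalHom_le_norm_toCStar (y : Y) (s : Torus n) (f : E.Conv) :
    ‖evalHom E y s f‖ ≤ ‖E.toCStar f‖ := by
  -- A non-degenerate representation needs a non-zero character; when the bound is not trivial, `f`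
  -- itself witnesses this.
  by_cases hf : evalHom E y s f = 0
  · rw [hf, norm_zero]
    exact norm_nonneg _
  · have h1 := lp.norm_apply_le_norm ENNReal.top_ne_zero
      (E.universalRep f : lp (fun r : E.Rep => r.H →L[ℂ] r.H) ∞) (evalRep E y s ⟨f, hf⟩)
    have h2 := Algebra.norm_smul_one_eq_norm (evalHom E y s f)
      (𝕜' := EuclideanSpace ℂ PUnit.{u + 1} →L[ℂ] EuclideanSpace ℂ PUnit.{u + 1})
    exact h2.ge.trans h1

end EvalRep

section UpperBound

variable {Y : Type*} [TopologicalSpace Y] [T2Space Y] {E : EtaleBundle Y (Fin n → ℤ)}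

/-- Each of the at most `S.card` coefficients over `y` is bounded by the sup norm of the
trigonometric polynomial. -/
theorem iNorm_le_card_mul (f : E.Conv) (S : Finset (Fin n → ℤ))
    (hS : ∀ y k, f.zeroExt (y, k) ≠ 0 → k ∈ S) {C : ℝ} (hC : ∀ y s, ‖evalHom E y s f‖ ≤ C) :
    f.iNorm ≤ ENNReal.ofReal (S.card * C) := by
  refine iSup_le fun y => ?_
  rw [tsum_enorm_eq_sum f y (hS y)]
  calc ∑ k ∈ S, ‖f.zeroExt (y, k)‖ₑ ≤ ∑ _k ∈ S, ENNReal.ofReal C := by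
        refine Finset.sum_le_sum fun k hk => ?_
        rw [← ofReal_norm]
        refine ENNReal.ofReal_le_ofReal (norm_coeff_le_of_forall_norm_sum_bracket_le S
          (fun l => f.zeroExt (y, l)) (fun s => ?_) hk)
        rw [← evalHom_eq_sum y s f (hS y)]
        exact hC y s
    _ = ENNReal.ofReal (S.card * C) := by
        rw [Finset.sum_const, nsmul_eq_mul, ENNReal.ofReal_mul (Nat.cast_nonneg _),
          ENNReal.ofReal_natCast]

/-- For self-adjoint `f`, `‖π f‖ ^ 2 ^ j` is the norm of `π g` with `g` the `2 ^ j`-th convolution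
power of `f`. The labels of `g` lie in the box of radius `2 ^ j * N`, so its `I`-norm is at most `(2
* 2 ^ j * N + 1) ^ n * C ^ 2 ^ j`; the polynomial factor disappears in the limit. -/
theorem norm_rep_le_of_isSelfAdjoint (r : E.Rep) {f : E.Conv} (hf : IsSelfAdjoint f) {C : ℝ}
    (hC0 : 0 ≤ C) (hC : ∀ y s, ‖evalHom E y s f‖ ≤ C) : ‖r.π f‖ ≤ C := by
  obtain ⟨N, hN⟩ := exists_subset_intBox f.labels
  refine le_of_forall_pow_two_pow_le (norm_nonneg _) hC0 N n fun j => ?_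
  -- The convolution algebra need not have a unit, so the power is built by repeated squaring.
  have key : ∃ g : E.Conv, r.π g = r.π f ^ 2 ^ j ∧
      (∀ y s, evalHom E y s g = evalHom E y s f ^ 2 ^ j) ∧
      ∀ y k, g.zeroExt (y, k) ≠ 0 → k ∈ intBox n (2 ^ j * N) := by
    induction j with
    | zero =>
      refine ⟨f, by simp, by simp, fun y k hk => ?_⟩
      rw [pow_zero, one_mul]
      exact hN (mem_labels_of_zeroExt hk)
    | succ j ih =>
      obtain ⟨g, h1, h2, h3⟩ := ih
      refine ⟨g * g, ?_, fun y s => ?_, fun y k hk => ?_⟩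
      · rw [map_mul, h1, ← pow_add, ← two_mul, ← pow_succ']
      · rw [map_mul, h2, ← pow_add, ← two_mul, ← pow_succ']
      · obtain ⟨l, hl, hl'⟩ := exists_zeroExt_ne_zero_of_mul hk
        have h4 := add_mem_intBox (h3 y _ hl) (h3 y _ hl')
        rwa [add_sub_cancel, ← two_mul, ← mul_assoc, ← pow_succ'] at h4
  obtain ⟨g, h1, h2, h3⟩ := key
  have hb := (r.bounded g).trans (iNorm_le_card_mul g _ h3 (C := C ^ 2 ^ j) fun y s => by
    rw [h2, norm_pow]
    exact pow_le_pow_left₀ (norm_nonneg _) (hC y s) _)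
  rw [← ofReal_norm, ENNReal.ofReal_le_ofReal_iff (by positivity), h1,
    (hf.map r.π).norm_pow_two_pow, card_intBox] at hb
  exact_mod_cast hb

/-- The C⋆-identity reduces the bound to the self-adjoint element `star f * f`. -/
theorem norm_rep_le (r : E.Rep) (f : E.Conv) {C : ℝ} (hC0 : 0 ≤ C)
    (hC : ∀ y s, ‖evalHom E y s f‖ ≤ C) : ‖r.π f‖ ≤ C := by
  have h1 : ‖r.π (star f * f)‖ ≤ C ^ 2 := by
    refine norm_rep_le_of_isSelfAdjoint r (IsSelfAdjoint.star_mul_self f) (by positivity)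
      fun y s => ?_
    rw [map_mul, map_star, CStarRing.norm_star_mul_self, ← sq]
    exact pow_le_pow_left₀ (norm_nonneg _) (hC y s) _
  rw [map_mul, map_star, CStarRing.norm_star_mul_self, ← sq] at h1
  exact le_of_sq_le_sq h1 hC0

end UpperBound

variable {M : Type*} [MulAction (Torus n) M] [TopologicalSpace M] [T2Space M]
  [ContinuousSMul (Torus n) M] (h : IsLocalHomeomorph (dualProj n M)) (σ : C(Delta n M, M))
  (hσ : ∀ y, J n M (σ y) = y)

theorem norm_toCStar_eq_norm_gelfandHom (f : (G₀ n M h).Conv) :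
    ‖(G₀ n M h).toCStar f‖ = ‖gelfandHom h σ hσ f‖ := by
  apply le_antisymm
  · rw [norm_toCStar]
    refine Real.iSup_le (fun r => norm_rep_le r f (norm_nonneg _) fun y s => ?_) (norm_nonneg _)
    rw [← gelfandHom_smul_section h σ hσ f y s]
    exact (gelfandHom h σ hσ f).toBCF.norm_coe_le_norm _
  · rw [← ZeroAtInftyContinuousMap.norm_toBCF_eq_norm,
      BoundedContinuousFunction.norm_le (norm_nonneg _)]
    exact fun x => norm_evalHom_le_norm_toCStar _ _ _ f

end TorusSpace

end NormComparison

/-! ### Density of the transform -/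

noncomputable section DenseRange

namespace EtaleBundle.Conv

variable {Y : Type*} {A : Type*} [TopologicalSpace Y] [AddCommGroup A] [TopologicalSpace A]
  [DiscreteTopology A] [T2Space Y] {E : EtaleBundle Y A}

open Classical in
/-- The function on `E` equal to `φ` on the slice `{(y, k) | k ∈ E_y}` and to zero elsewhere. -/
def single (k : A) (φ : C(Y, ℂ)) (hφ : IsCompact (tsupport φ))
    (hk : tsupport φ ⊆ {y | k ∈ E.fiber y}) : E.Conv :=
  (⟨⟨fun p => φ p.1.1 * if p.1.2 = k then 1 else 0, by
      have h1 : Continuous fun l : A => if l = k then (1 : ℂ) else 0 :=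
        continuous_of_discreteTopology
      exact (φ.continuous.comp (continuous_fst.comp continuous_subtype_val)).mul
        (h1.comp (continuous_snd.comp continuous_subtype_val))⟩, by
    have : CompactSpace (tsupport φ) := isCompact_iff_compactSpace.mp hφ
    have hc : Continuous fun y : tsupport φ => (⟨(y, k), hk y.2⟩ : E.Total) := by fun_prop
    refine HasCompactSupport.intro (isCompact_range hc) fun p hp => ?_
    by_contra hne
    have h1 : p.1.1 ∈ tsupport φ := subset_tsupport _ (left_ne_zero_of_mul hne)
    have h2 : p.1.2 = k := by
      by_contra h2
      exact right_ne_zero_of_mul hne (if_neg h2)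
    exact hp ⟨⟨p.1.1, h1⟩, Subtype.ext (Prod.ext rfl h2.symm)⟩⟩ : C_c(E.Total, ℂ))

open Classical in
theorem zeroExt_single (k : A) (φ : C(Y, ℂ)) (hφ : IsCompact (tsupport φ))
    (hk : tsupport φ ⊆ {y | k ∈ E.fiber y}) (y : Y) (l : A) :
    (single k φ hφ hk).zeroExt (y, l) = φ y * if l = k then 1 else 0 := by
  by_cases hl : l ∈ E.fiber y
  · rw [zeroExt_mk _ _ _ hl]
    rfl
  · rw [zeroExt_not_mem _ _ _ hl]
    split_ifs with h
    · subst h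
      rw [image_eq_zero_of_notMem_tsupport fun h => hl (hk h), zero_mul]
    · rw [mul_zero]

end EtaleBundle.Conv

namespace TorusSpace

open EtaleBundle EtaleBundle.Conv

variable {n : ℕ}

theorem evalHom_single {Y : Type*} [TopologicalSpace Y] [T2Space Y]
    {E : EtaleBundle Y (Fin n → ℤ)} (k : Fin n → ℤ) (φ : C(Y, ℂ)) (hφ : IsCompact (tsupport φ))
    (hk : tsupport φ ⊆ {y | k ∈ E.fiber y}) (y : Y) (s : Torus n) :
    evalHom E y s (single k φ hφ hk) = φ y * (bracket k s : ℂ) := by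
  rw [evalHom_eq_sum y s _ (S := {k}) fun l hl => ?_]
  · simp [zeroExt_single]
  · rw [zeroExt_single] at hl
    by_contra hne
    rw [Finset.mem_singleton] at hne
    exact hl (by rw [if_neg hne, mul_zero])

/-- Since `E` is étale, the `y` with `k` in the fibre form an open set; a Urysohn function supported
there and in `U`, placed on the slice of label `k`, has the required values. -/
theorem exists_conv_evalHom_eq_bracket {Y : Type*} [TopologicalSpace Y] [T2Space Y]
    [LocallyCompactSpace Y] (E : EtaleBundle Y (Fin n → ℤ)) {k : Fin n → ℤ} {y : Y}
    (hk : k ∈ E.fiber y) {U : Set Y} (hU : IsOpen U) (hy : y ∈ U) :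
    ∃ f : E.Conv, (∀ s, evalHom E y s f = bracket k s) ∧
      ∀ z ∉ U, ∀ s, evalHom E z s f = 0 := by
  have hV : IsOpen {y | k ∈ E.fiber y} :=
    (isOpen_total E).preimage (continuous_id.prodMk continuous_const)
  obtain ⟨φ, h1, h2, h3, -⟩ := exists_continuousMap_one_of_isCompact_subset_isOpen
    (isCompact_singleton (x := y)) (hV.inter hU) (singleton_subset_iff.mpr ⟨hk, hy⟩)
  let ψ : C(Y, ℂ) := ⟨fun y => (φ y : ℂ), by fun_prop⟩
  have hψ : tsupport ψ ⊆ tsupport φ := closure_mono fun z hz hφ => hz (by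
    change (φ z : ℂ) = 0
    rw [hφ, Complex.ofReal_zero])
  refine ⟨single k ψ (h2.of_isClosed_subset isClosed_closure hψ)
    (hψ.trans (h3.trans inter_subset_left)), fun s => ?_, fun z hz s => ?_⟩
  · have h4 : ψ y = 1 := by
      change (φ y : ℂ) = 1
      rw [h1 rfl, Pi.one_apply, Complex.ofReal_one]
    rw [evalHom_single, h4, one_mul]
  · rw [evalHom_single, image_eq_zero_of_notMem_tsupport fun h => hz (h3 (hψ h)).2, zero_mul]

variable {M : Type*} [MulAction (Torus n) M] [TopologicalSpace M] [T2Space M]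
  [LocallyCompactSpace M] [ContinuousSMul (Torus n) M]

/-- The characters in the dual of `𝕋ⁿ/𝕋ⁿ_y` separate the points of the orbit over `y`. -/
theorem exists_bracket_ne_of_smul_ne {y : Delta n M} {x : M} (hx : J n M x = y) {s t : Torus n}
    (hst : s • x ≠ t • x) : ∃ k ∈ dualFiber n M y, bracket k s ≠ bracket k t := by
  obtain ⟨φ, h1, -, h3, -⟩ := exists_continuousMap_one_of_isCompact_subset_isOpen
    (isCompact_singleton (x := s • x)) (isOpen_compl_singleton (x := t • x))
    (singleton_subset_iff.mpr hst)
  have hs : φ (s • x) = 1 := h1 rfl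
  have ht : φ (t • x) = 0 := image_eq_zero_of_notMem_tsupport fun h => h3 h rfl
  -- The orbit function `t ↦ φ (t • x)` is invariant under the isotropy group, but translation by
  -- `s⁻¹ * t` changes its value at `s` from `1` to `0`.
  obtain ⟨k, hk, hkr⟩ := exists_bracket_ne_one (isotropy n M y)
    (fun t => (φ (t • x) : ℂ)) (by fun_prop)
    (fun g hg t => by simp only [mul_smul, (mem_isotropy_iff hx).mp hg])
    (r := s⁻¹ * t) (s := s) (by simp [hs, ht])
  refine ⟨k, hk, fun h => hkr ?_⟩
  have h2 := bracket_mul k s (s⁻¹ * t)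
  rw [mul_inv_cancel_left, h] at h2
  exact mul_eq_left.mp h2.symm

theorem denseRange_gelfandHom (h : IsLocalHomeomorph (dualProj n M)) (σ : C(Delta n M, M))
    (hσ : ∀ y, J n M (σ y) = y) : DenseRange (gelfandHom h σ hσ) := by
  refine (NonUnitalStarAlgHom.range (gelfandHom h σ hσ)).dense_of_separatesPoints
    (fun x => ?_) fun x z hxz => ?_
  · obtain ⟨f, hf, -⟩ := exists_conv_evalHom_eq_bracket (G₀ n M h)
      (zero_mem ((G₀ n M h).fiber (J n M x))) isOpen_univ (mem_univ _)
    refine ⟨_, ⟨f, rfl⟩, ?_⟩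
    change gelfandHom h σ hσ f x ≠ 0
    rw [gelfandHom_apply, hf]
    exact Circle.coe_ne_zero _
  -- On a common orbit a character of the dual fibre separates; on different orbits a bump on the
  -- zero label does.
  · by_cases hJ : J n M x = J n M z
    · have hne : torusCoord hσ x • σ (J n M x) ≠ torusCoord hσ z • σ (J n M x) := by
        rw [torusCoord_smul, hJ, torusCoord_smul]
        exact hxz
      obtain ⟨k, hk, hkn⟩ := exists_bracket_ne_of_smul_ne (hσ _) hne
      obtain ⟨f, hf, -⟩ := exists_conv_evalHom_eq_bracket (G₀ n M h) (k := k) hk isOpen_univ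
        (mem_univ _)
      refine ⟨_, ⟨f, rfl⟩, fun h1 => hkn (Circle.ext ?_)⟩
      change gelfandHom h σ hσ f x = gelfandHom h σ hσ f z at h1
      rwa [gelfandHom_apply, gelfandHom_apply, ← hJ, hf, hf] at h1
    · obtain ⟨f, hf, hf'⟩ := exists_conv_evalHom_eq_bracket (G₀ n M h)
        (zero_mem ((G₀ n M h).fiber (J n M x))) (isOpen_compl_singleton (x := J n M z)) hJ
      refine ⟨_, ⟨f, rfl⟩, ?_⟩
      change gelfandHom h σ hσ f x ≠ gelfandHom h σ hσ f z
      rw [gelfandHom_apply, gelfandHom_apply, hf, hf' _ fun h => h rfl]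
      exact Circle.coe_ne_zero _

end TorusSpace

end DenseRange

theorem mainTheorem4 {n : ℕ} {M : Type*} [TopologicalSpace M] [T2Space M] [LocallyCompactSpace M]
    [MulAction (TorusSpace.Torus n) M] [ContinuousSMul (TorusSpace.Torus n) M]
    (σ : C(TorusSpace.Delta n M, M)) (hσ : ∀ y, TorusSpace.J n M (σ y) = y) :
    (∀ k : Fin n → ℤ,
      IsOpen (TorusSpace.MSet n M k) ∧ Continuous (TorusSpace.kSigma hσ k)) ∧
    ∃ (h : IsLocalHomeomorph (TorusSpace.dualProj n M))
      (I : C₀(M, ℂ) ≃⋆ₐ[ℂ] (TorusSpace.G₀ n M h).CStar),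
      ∀ (f : (TorusSpace.G₀ n M h).Conv) (x : M),
        HasSum
          (fun k : TorusSpace.dualFiber n M (TorusSpace.J n M x) =>
            f ⟨(TorusSpace.J n M x, (k : Fin n → ℤ)), k.2⟩ *
              (TorusSpace.kSigma hσ (k : Fin n → ℤ) ⟨x, k.2⟩ : ℂ))
          (I.symm ((TorusSpace.G₀ n M h).toCStar f) x) := by
  refine ⟨fun k => ⟨TorusSpace.isOpen_MSet σ hσ k, TorusSpace.continuous_kSigma σ hσ k⟩,
    TorusSpace.isLocalHomeomorph_dualProj σ hσ, ?_⟩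
  set h := TorusSpace.isLocalHomeomorph_dualProj σ hσ
  obtain ⟨I, hI⟩ := exists_starAlgEquiv_of_denseRange (TorusSpace.gelfandHom h σ hσ)
    (TorusSpace.G₀ n M h).toCStar (TorusSpace.denseRange_gelfandHom h σ hσ)
    (TorusSpace.G₀ n M h).denseRange_toCStar
    fun f => (TorusSpace.norm_toCStar_eq_norm_gelfandHom h σ hσ f).symm
  refine ⟨I, fun f x => ?_⟩
  rw [← hI f, I.symm_apply_apply]
  -- `kSigma` and `torusCoord` use the same chosen torus element, so the two sums agree by
  -- definition.
  exact TorusSpace.hasSum_evalHom (E := TorusSpace.G₀ n M h) (TorusSpace.J n M x)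
    (TorusSpace.torusCoord hσ x) f
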